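/- **Setting.** Fix a state space $\mathcal X=\mathbb R^d$, $d\ge 1$, and a time step $k\ge 1$. The trajectory space at time $\kappa$ is $\mathcal T_\kappa=\biguplus_{0\le\beta\le\varepsilon\le \kappa}\{\beta\}\times\{\varepsilon\}\times\mathcal X^{\varepsilon-\beta+1}$ with elements $X=(\beta,\varepsilon,x_{\beta:\varepsilon})$; $\int\cdot\,dX$ denotes the sum over $(\beta,\varepsilon)$ of Lebesgue integrals, and $\langle g;h\rangle=\int g(X)h(X)\,dX$. A distribution on the finite subsets of $\mathcal T_\kappa$ has density $f$ if its value on each measurable $A$ is the set integral of $f\mathbf 1_A$, where $\int g(\mathbf X)\,\delta\mathbf X=g(\emptyset)+\sum_{n\ge1}\frac1{n!}\int g(\{X^1,\dots,X^n\})\,dX^1\cdots dX^n$. The Bernoulli density with parameters $(r,f)$, $r\in[0,1]$, $f$ a probability density, is $1-r$ at $\emptyset$, $rf(X)$ at $\{X\}$ and $0$ otherwise; if $r=0$ the mass of $f$ is left unconstrained. A *trajectory multi-Bernoulli mixture (MBM)* with $n$ tracks has, for each track $i\in\{1,\dots,n\}$ and each of its hypotheses $a^i\in\{1,\dots,h^i\}$,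 a measurement history $\mathcal M(i,a^i)$ (a finite set of measurement indices), a weight $w^{i,a^i}\ge 0$ and Bernoulli parameters $(r^{i,a^i},f^{i,a^i})$ with Bernoulli density $f_{\mathrm{ber}}^{i,a^i}$. Given the set $\mathcal M$ of the indices $(\tau,j)$ of all measurements received so far, its global hypotheses are the tuples $a=(a^1,\dots,a^n)$ such that the sets $\mathcal M(i,a^i)$ are contained in $\mathcal M$ and pairwise disjoint; they form the set $\mathcal A$. The weights are $w^a=\prod_i w^{i,a^i}\big/\sum_{b\in\mathcal A}\prod_i w^{i,b^i}$ (the denominator is assumed nonzero), and the MBM density is $$f(\mathbf X)=\sum_{a\in\mathcal A}w^a\sum_{\mathbf X^1\uplus\cdots\uplus\mathbf X^n=\mathbf X}\ \prod_{i=1}^n f_{\mathrm{ber}}^{i,a^i}(\mathbf X^i).$$ **Transition model for the set of current trajectories.** Let $P^S:\mathcal X\to[0,1]$ be measurable, let $\pi^x(\cdot|x)$ be a measurable Markov transition density on $\mathcal X$, and put $P^S_{k-1}(X')=P^S(x'_{\varepsilon'})$ if $\varepsilon'=k-1$, and $0$ otherwise. Given the set $\mathbf X_{k-1}$ at time $k-1$,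 the set at time $k$ is the union of independent sets: for each $X'=(\beta',\varepsilon',x')\in\mathbf X_{k-1}$, a Bernoulli set with existence probability $P^S_{k-1}(X')$ whose element, if any, has the law $\pi^c(\cdot|X')$ of $(\beta',\varepsilon'+1,(x'_{\beta':\varepsilon'},y))$ with $y\sim\pi^x(\cdot|x'_{\varepsilon'})$; and a set of newborn trajectories which is the union of $n^b_k$ independent Bernoulli sets with parameters $(r^{b,l}_k,f^{B,l}_k)$, $l=1,\dots,n^b_k$, where $f^{B,l}_k(\beta,\varepsilon,x_{\beta:\varepsilon})=f^{b,l}_k(x_k)$ if $\beta=\varepsilon=k$, and $0$ otherwise, for a probability density $f^{b,l}_k$ on $\mathcal X$. **Theorem.** Suppose that the set of trajectories at time $k-1$, given the measurements up to time $k-1$, has the density of a trajectory MBM with $n_{k-1|k-1}$ tracks and parameters $h^i_{k-1|k-1}$, $\mathcal M^{k-1}(i,a^i)$, $w^{i,a^i}_{k-1|k-1}$, $r^{i,a^i}_{k-1|k-1}$, $f^{i,a^i}_{k-1|k-1}$. Then the predicted distribution at time $k$, obtained by averaging the transition law over the distribution at time $k-1$, again has the density of a trajectory MBM, with $n_{k|k-1}=n_{k-1|k-1}+n^b_k$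 tracks and the following parameters. For continuing tracks $i\in\{1,\dots,n_{k-1|k-1}\}$: $h^i_{k|k-1}=h^i_{k-1|k-1}$, and for every $a^i$ the measurement history is unchanged, $w^{i,a^i}_{k|k-1}=w^{i,a^i}_{k-1|k-1}$, $$r^{i,a^i}_{k|k-1}=r^{i,a^i}_{k-1|k-1}\langle f^{i,a^i}_{k-1|k-1};P^S_{k-1}\rangle,\qquad f^{i,a^i}_{k|k-1}(X)=\frac{\langle f^{i,a^i}_{k-1|k-1};\pi^c(X|\cdot)P^S_{k-1}\rangle}{\langle f^{i,a^i}_{k-1|k-1};P^S_{k-1}\rangle}.$$ (If the denominator is $0$, then $r^{i,a^i}_{k|k-1}=0$ and $f^{i,a^i}_{k|k-1}$ plays no role.) Here $\langle f;\pi^c(X|\cdot)P^S_{k-1}\rangle$, as a function of $X=(\beta,\varepsilon,x_{\beta:\varepsilon})\in\mathcal T_k$, is the density of the measure $\int f(X')P^S_{k-1}(X')\,\pi^c(\cdot|X')\,dX'$, namely $f(X')P^S_{k-1}(X')\pi^x(x_\varepsilon|x_{\varepsilon-1})$ with $X'=(\beta,\varepsilon-1,x_{\beta:\varepsilon-1})$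 if $\beta<\varepsilon$, and $0$ if $\beta=\varepsilon$. For new tracks $i=n_{k-1|k-1}+l$, $l\in\{1,\dots,n^b_k\}$: $h^i_{k|k-1}=1$, $\mathcal M^{k-1}(i,1)=\emptyset$, $w^{i,1}_{k|k-1}=1$, $r^{i,1}_{k|k-1}=r^{b,l}_k$, $f^{i,1}_{k|k-1}=f^{B,l}_k$. -/

import Mathlib

open MeasureTheory
open scoped ENNReal NNReal

noncomputable section

namespace TrajRFS

/-! ### Finite subsets of a single-object space -/

/-- The space of all finite subsets of `E`. It is a copy of `Finset E`, because Mathlib puts on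
`Finset E` the `σ`-algebra generated by the events "`x` belongs to the set" for single points `x`,
which is too small for random finite sets in an uncountable space. -/
@[ext]
structure FinSub (E : Type*) where
  pts : Finset E

/-- The `σ`-algebra on the finite subsets of `E` generated by the events
"no point of the set lies in `C`", for `C` a measurable subset of `E`. -/
instance finSubMeasurableSpace (E : Type*) [MeasurableSpace E] : MeasurableSpace (FinSub E) :=
  MeasurableSpace.generateFrom
    {s | ∃ C : Set E, MeasurableSet C ∧ s = {F : FinSub E | ∀ x ∈ F.pts, x ∉ C}}

section RFS

variable {E : Type*}

open scoped Classical in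
/-- The set `{x 0, ..., x (n-1)}` of the entries of a tuple. -/
def tupleSet {n : ℕ} (x : Fin n → E) : FinSub E := ⟨Finset.univ.image x⟩

/-- The set integral `g(∅) + ∑_{n ≥ 1} (1/n!) ∫ ⋯ ∫ g({x₁,…,xₙ}) ν(dx₁) ⋯ ν(dxₙ)` of a nonnegative
function on finite sets (the term `n = 0` is `g(∅)`). -/
def setIntegral [MeasurableSpace E] (ν : Measure E) (g : FinSub E → ℝ≥0∞) : ℝ≥0∞ :=
  ∑' n : ℕ, ((n.factorial : ℝ≥0∞))⁻¹ *
    ∫⁻ x : Fin n → E, g (tupleSet x) ∂(Measure.pi fun _ => ν)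

/-- `P`, a distribution on the finite subsets of `E`, has multi-object density `g` (with respect
to the set integral over `ν`). -/
def HasSetDensity [MeasurableSpace E] (ν : Measure E) (P : Measure (FinSub E))
    (g : FinSub E → ℝ≥0∞) : Prop :=
  ∀ A : Set (FinSub E), MeasurableSet A → P A = setIntegral ν (A.indicator g)

open scoped Classical in
/-- The multi-object density of a Bernoulli RFS: `1 - r` at `∅`, `r * f x` at `{x}` and `0` at all
sets of two or more points. -/
def bernoulliDensity (r : ℝ≥0∞) (f : E → ℝ≥0∞) (X : Finset E) : ℝ≥0∞ :=
  if X = ∅ then 1 - r else if X.card = 1 then r * ∏ x ∈ X, f x else 0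

/-- `r` is a probability of existence and `f` is a probability density with respect to `ν`. When
`r = 0` the Bernoulli RFS is empty and `f` plays no role, so that its mass is not constrained. -/
structure IsBernoulliParam [MeasurableSpace E] (ν : Measure E) (r : ℝ≥0∞) (f : E → ℝ≥0∞) :
    Prop where
  le_one : r ≤ 1
  measurable : Measurable f
  lintegral_eq_one : r ≠ 0 → ∫⁻ x, f x ∂ν = 1

open scoped Classical in
/-- The families `(X¹,…,Xⁿ)` of pairwise disjoint sets whose union is `X`. -/
def orderedPartitions (n : ℕ) (X : Finset E) : Finset (Fin n → Finset E) :=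
  (Fintype.piFinset fun _ : Fin n => X.powerset).filter fun Y =>
    (∀ i j, i ≠ j → Disjoint (Y i) (Y j)) ∧ Finset.univ.biUnion Y = X

/-- The law of a Bernoulli RFS with existence probability `r` whose point, if it exists, has
law `ν`. -/
def bernoulliLaw [MeasurableSpace E] (r : ℝ≥0∞) (ν : Measure E) : Measure (FinSub E) :=
  (1 - r) • Measure.dirac (⟨∅⟩ : FinSub E) + r • ν.map fun x => (⟨{x}⟩ : FinSub E)

open scoped Classical in
/-- The law of the union of finitely many independent random finite sets with laws `P i`. -/
def unionLaw [MeasurableSpace E] {ι : Type*} [Fintype ι] (P : ι → Measure (FinSub E)) :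
    Measure (FinSub E) :=
  (Measure.pi P).map fun Y => ⟨Finset.univ.biUnion fun i => (Y i).pts⟩

open scoped Classical in
/-- The law of the union of two independent random finite sets with laws `P` and `Q`. -/
def unionLaw₂ [MeasurableSpace E] (P Q : Measure (FinSub E)) : Measure (FinSub E) :=
  (P.prod Q).map fun Y => ⟨Y.1.pts ∪ Y.2.pts⟩

end RFS

/-! ### Trajectories -/

/-- The single-target state space `ℝᵈ`. -/
abbrev State (d : ℕ) : Type := EuclideanSpace ℝ (Fin d)

/-- The trajectory state space at time step `k`: a birth time `β` and an end time `ε` with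
`0 ≤ β ≤ ε ≤ k`, together with the `ε - β + 1` states `x_β, …, x_ε`, where `x_{β + j}` is the entry
of index `j`. -/
abbrev Traj (d k : ℕ) : Type :=
  Σ I : {I : ℕ × ℕ // I.1 ≤ I.2 ∧ I.2 ≤ k}, (Fin (I.1.2 - I.1.1 + 1) → State d)

/-- The reference measure of the trajectory space: the sum over all `(β, ε)` of the Lebesgue
measures on `(ℝᵈ)^(ε - β + 1)`. -/
def trajMeasure (d k : ℕ) : Measure (Traj d k) :=
  Measure.sum fun I : {I : ℕ × ℕ // I.1 ≤ I.2 ∧ I.2 ≤ k} =>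
    (volume : Measure (Fin (I.1.2 - I.1.1 + 1) → State d)).map
      (fun x => (⟨I, x⟩ : Traj d k))

namespace Traj

variable {d k : ℕ}

/-- The birth time `β`. -/
def birthTime (X : Traj d k) : ℕ := X.1.1.1

/-- The end time `ε`. -/
def endTime (X : Traj d k) : ℕ := X.1.1.2

/-- The last state `x_ε`. -/
def last (X : Traj d k) : State d := X.2 (Fin.last _)

/-- The trajectory `(β, ε + 1, (x_β, …, x_ε, y))`. -/
def extend (X : Traj d k) (y : State d) : Traj d (k + 1) :=
  ⟨⟨(X.1.1.1, X.1.1.2 + 1), Nat.le_succ_of_le X.1.2.1, Nat.succ_le_succ X.1.2.2⟩,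
    fun j => if h : j.val < X.1.1.2 - X.1.1.1 + 1 then X.2 ⟨j.val, h⟩ else y⟩

/-- The trajectory `(β, ε - 1, (x_β, …, x_{ε-1}))`, for `β < ε`. -/
def parent (X : Traj d (k + 1)) (h : X.1.1.1 < X.1.1.2) : Traj d k :=
  ⟨⟨(X.1.1.1, X.1.1.2 - 1), Nat.le_sub_one_of_lt h, Nat.sub_le_of_le_add X.1.2.2⟩,
    fun j => X.2 ⟨j.val, lt_of_lt_of_le j.isLt
      (Nat.succ_le_succ (Nat.sub_le_sub_right (Nat.sub_le _ 1) _))⟩⟩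

end Traj

/-- The survival probability `P^S_k(X) = P^S(x_ε) Δ_k(ε)` of a trajectory at time step `k`. -/
def survProb {d : ℕ} (PS : State d → ℝ≥0∞) (k : ℕ) (X : Traj d k) : ℝ≥0∞ :=
  if X.endTime = k then PS X.last else 0

/-- The transition `π^c(· | X')` of a surviving trajectory, with `π x y` the density at `y` of the
state that follows `x`. It is a measure because it contains a Dirac mass at the past states: the
law of `X'` extended by a new state drawn from `π(· | x'_{ε'})`. -/
def survTransition {d : ℕ} (π : State d → State d → ℝ≥0∞) {k : ℕ} (X' : Traj d k) :
    Measure (Traj d (k + 1)) :=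
  ((volume : Measure (State d)).withDensity (π X'.last)).map X'.extend

/-- The birth density `f^B(X) = f^b(x_k) Δ_k(ε) Δ_k(β)` on trajectories at time step `k`. -/
def birthDensity {d : ℕ} (fb : State d → ℝ≥0∞) (k : ℕ) (X : Traj d k) : ℝ≥0∞ :=
  if X.endTime = k ∧ X.birthTime = k then fb X.last else 0

/-- The law of the set of current trajectories at time step `k + 1` given that the set at time step
`k` is `F`: the union of independent sets, namely a multi-Bernoulli set of newborn trajectories and,
for each `X' ∈ F`, a Bernoulli set with existence probability `P^S_k(X')` and law `π^c(· | X')`. -/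
def currentTransition {d : ℕ} (PS : State d → ℝ≥0∞) (π : State d → State d → ℝ≥0∞) {nb : ℕ}
    (rb : Fin nb → ℝ≥0∞) (fb : Fin nb → State d → ℝ≥0∞) (k : ℕ) (F : FinSub (Traj d k)) :
    Measure (FinSub (Traj d (k + 1))) :=
  unionLaw₂
    (unionLaw fun l : Fin nb =>
      bernoulliLaw (rb l) ((trajMeasure d (k + 1)).withDensity (birthDensity (fb l) (k + 1))))
    (unionLaw fun X' : {X' // X' ∈ F.pts} =>
      bernoulliLaw (survProb PS k X'.1) (survTransition π X'.1))

/-- The inner product `⟨f; P^S_k⟩`. -/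
def survInner {d : ℕ} (PS : State d → ℝ≥0∞) {k : ℕ} (f : Traj d k → ℝ≥0∞) : ℝ≥0∞ :=
  ∫⁻ X', f X' * survProb PS k X' ∂(trajMeasure d k)

/-- The inner product `⟨f; π^c P^S_k⟩` as a function of the new trajectory `X`. Integrating out the
Dirac mass in `π^c(X | X')` leaves the value at the only possible predecessor of `X`, if any. -/
def survTransInner {d : ℕ} (PS : State d → ℝ≥0∞) (π : State d → State d → ℝ≥0∞) {k : ℕ}
    (f : Traj d k → ℝ≥0∞) (X : Traj d (k + 1)) : ℝ≥0∞ :=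
  if h : X.1.1.1 < X.1.1.2 then
    f (X.parent h) * survProb PS k (X.parent h) * π (X.parent h).last X.last
  else 0

/-! ### Trajectory multi-Bernoulli mixtures -/

/-- The indices `(τ, j)`, `1 ≤ τ ≤ k`, `1 ≤ j ≤ m τ`, of the measurements received up to and
including time step `k`, where `m τ` is the number of measurements at time step `τ`. -/
def measIndices (m : ℕ → ℕ) (k : ℕ) : Finset (ℕ × ℕ) :=
  (Finset.Icc 1 k).biUnion fun τ => (Finset.Icc 1 (m τ)).image fun j => (τ, j)

/-- The parameters of a trajectory MBM with `n` tracks on the trajectory space at time step `k`.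
Track `i` has the single-trajectory hypotheses `a ∈ {1, …, h i}`; hypothesis `a` has the measurement
history `hist i a`, the weight `w i a`, the existence probability `r i a` and the density `f i a`.
Values at other `a` are never used. -/
structure TrajMBM (d k n : ℕ) where
  h : Fin n → ℕ
  hist : Fin n → ℕ → Finset (ℕ × ℕ)
  w : Fin n → ℕ → ℝ≥0
  r : Fin n → ℕ → ℝ≥0∞
  f : Fin n → ℕ → Traj d k → ℝ≥0∞

namespace TrajMBM

variable {d k n : ℕ}

open scoped Classical in
/-- The global hypotheses, given the set `𝓜` of all measurement indices received so far. -/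
def globalHyps (θ : TrajMBM d k n) (𝓜 : Finset (ℕ × ℕ)) : Finset (Fin n → ℕ) :=
  (Fintype.piFinset fun i => Finset.Icc 1 (θ.h i)).filter fun a =>
    (Finset.univ.biUnion fun i => θ.hist i (a i)) ⊆ 𝓜 ∧
      ∀ i j, i ≠ j → Disjoint (θ.hist i (a i)) (θ.hist j (a j))

/-- The normalized weight `w^a ∝ ∏ i, w^{i,a^i}` of a global hypothesis. -/
def globalWeight (θ : TrajMBM d k n) (𝓜 : Finset (ℕ × ℕ)) (a : Fin n → ℕ) : ℝ≥0 :=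
  (∏ i, θ.w i (a i)) / ∑ b ∈ θ.globalHyps 𝓜, ∏ i, θ.w i (b i)

/-- The multi-trajectory density of the MBM. -/
def density (θ : TrajMBM d k n) (𝓜 : Finset (ℕ × ℕ)) (X : FinSub (Traj d k)) : ℝ≥0∞ :=
  ∑ a ∈ θ.globalHyps 𝓜, (θ.globalWeight 𝓜 a : ℝ≥0∞) *
    ∑ Y ∈ orderedPartitions n X.pts, ∏ i, bernoulliDensity (θ.r i (a i)) (θ.f i (a i)) (Y i)

/-- The parameters are those of a trajectory MBM: every hypothesis carries Bernoulli parameters, and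
the weights of the global hypotheses can be normalized. -/
structure Valid (θ : TrajMBM d k n) (𝓜 : Finset (ℕ × ℕ)) : Prop where
  bernoulli : ∀ i, ∀ a ∈ Finset.Icc 1 (θ.h i),
    IsBernoulliParam (trajMeasure d k) (θ.r i a) (θ.f i a)
  weight_ne_zero : ∑ b ∈ θ.globalHyps 𝓜, ∏ i, θ.w i (b i) ≠ 0

end TrajMBM

end TrajRFS

end

open TrajRFS MeasureTheory
open scoped ENNReal NNReal

/-! # Prediction of a trajectory multi-Bernoulli mixture

The events "the set has no point in `C`" form a π-system that generates the `σ`-algebra on finite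
sets, so a finite measure on finite sets is determined by its void probabilities
(`ext_of_voidEvent`). The void probability of a union of independent sets is a product
(`unionLaw_voidEvent`), hence the transition law satisfies
`K(F)(no point in C) = B(C) * ∏_{X' ∈ F} q_C(X')`, with `B(C)` the void probability of the newborn
set and `q_C(X') = 1 - P^S(X') + P^S(X') π^c(Cᶜ | X')` (`currentTransition_voidEvent`). Point
products such as this one are measurable in `F` (`measurable_prod_pts`), because counts of points
are; this makes `K` a Markov kernel, and it reduces the void probabilities of the predicted
distribution to the generating functional of the prior at `q_C`.

The reference measure has no atoms since `d > 0`, so almost every tuple of trajectories has distinct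
entries, and the sum over ordered partitions in the density becomes a sum over injective assignments
of points to tracks. The `m!` such assignments with a given set of occupied tracks cancel the
factor `1/m!` of the set integral, and the generating functional at `h` of a multi-Bernoulli density
is `∏_i (1 - r_i + r_i ∫ f_i h)` (`setIntegral_multiBernoulliDensity_mul_prod`). At `h = q_C` the
factor of track `i` is `1 - r'_i + r'_i ∫_{Cᶜ} f'_i` with the predicted parameters
(`pgfl_predict`); together with `B(C)` and the unchanged weights these are the void probabilities of
the predicted mixture.

The identity of densities behind `pgfl_predict` is `withDensity_survTransInner`: a trajectory of
length at least two is the extension of its parent by one state, and the reference measure splits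
accordingly (`lintegral_trajMeasure_succ`).
-/

namespace TrajRFS

/-! ### Void events and point counts -/

section Void

variable {E : Type*} [MeasurableSpace E]

/-- The event that a random finite set has no point in `C`. -/
def voidEvent (C : Set E) : Set (FinSub E) := {F | ∀ x ∈ F.pts, x ∉ C}

lemma voidEvent_empty {E : Type*} : voidEvent (∅ : Set E) = Set.univ := by
  simp [voidEvent]

lemma measurableSet_voidEvent {C : Set E} (hC : MeasurableSet C) :
    MeasurableSet (voidEvent C) :=
  MeasurableSpace.measurableSet_generateFrom ⟨C, hC, rfl⟩

lemma isPiSystem_voidEvent :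
    IsPiSystem {s | ∃ C : Set E, MeasurableSet C ∧ s = {F : FinSub E | ∀ x ∈ F.pts, x ∉ C}} := by
  rintro _ ⟨C, hC, rfl⟩ _ ⟨D, hD, rfl⟩ -
  refine ⟨C ∪ D, hC.union hD, ?_⟩
  ext F
  simp only [Set.mem_inter_iff, Set.mem_ofPred_eq, Set.mem_union, not_or]
  exact ⟨fun h x hx => ⟨h.1 x hx, h.2 x hx⟩,
    fun h => ⟨fun x hx => (h x hx).1, fun x hx => (h x hx).2⟩⟩

lemma measurable_of_voidEvent {α : Type*} [MeasurableSpace α] {φ : α → FinSub E}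
    (h : ∀ C, MeasurableSet C → MeasurableSet (φ ⁻¹' voidEvent C)) : Measurable φ := by
  refine measurable_generateFrom ?_
  rintro _ ⟨C, hC, rfl⟩
  exact h C hC

/-- Two finite measures on finite sets with the same void probabilities are equal. -/
lemma ext_of_voidEvent {μ ν : Measure (FinSub E)} [IsFiniteMeasure μ]
    (h : ∀ C, MeasurableSet C → μ (voidEvent C) = ν (voidEvent C)) : μ = ν := by
  refine ext_of_generate_finite _ rfl isPiSystem_voidEvent ?_ ?_
  · rintro _ ⟨C, hC, rfl⟩
    exact h C hC
  · simpa [voidEvent] using h ∅ MeasurableSet.empty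

lemma measurable_measure_of_voidEvent {α : Type*} [MeasurableSpace α] {K : α → Measure (FinSub E)}
    [∀ a, IsProbabilityMeasure (K a)]
    (h : ∀ C, MeasurableSet C → Measurable fun a => K a (voidEvent C)) : Measurable K := by
  refine Measurable.measure_of_isPiSystem_of_isProbabilityMeasure rfl isPiSystem_voidEvent ?_
  rintro _ ⟨C, hC, rfl⟩
  exact h C hC

lemma measurable_tupleSet (n : ℕ) : Measurable (tupleSet : (Fin n → E) → FinSub E) := by
  refine measurable_of_voidEvent fun C hC => ?_
  have : (tupleSet ⁻¹' voidEvent C : Set (Fin n → E)) = Set.pi Set.univ fun _ => Cᶜ := by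
    ext x
    simp [tupleSet, voidEvent]
  rw [this]
  exact MeasurableSet.univ_pi fun _ => hC.compl

lemma measurable_singleton_finSub : Measurable fun x : E => (⟨{x}⟩ : FinSub E) := by
  refine measurable_of_voidEvent fun C hC => ?_
  have : ((fun x : E => (⟨{x}⟩ : FinSub E)) ⁻¹' voidEvent C) = Cᶜ := by
    ext x
    simp [voidEvent]
  rw [this]
  exact hC.compl

open scoped Classical in
/-- The number of points in a measurable set is measurable: for a sequence of finite partitions that
separates points, it is the limit of the number of cells that contain a point of the set. -/
lemma measurable_count [MeasurableSpace.CountablySeparated E] {C : Set E} (hC : MeasurableSet C) :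
    Measurable fun F : FinSub E => (F.pts.filter (· ∈ C)).card := by
  obtain ⟨φ, hφ, hinj⟩ := MeasurableSpace.measurable_injection_nat_bool_of_countablySeparated E
  let cell (n : ℕ) (x : E) : Fin n → Bool := fun i => φ x i
  have hcell (n : ℕ) : Measurable (cell n) :=
    measurable_pi_lambda _ fun i => (measurable_pi_apply (i : ℕ)).comp hφ
  let N (n : ℕ) (F : FinSub E) : ℕ := ((F.pts.filter (· ∈ C)).image (cell n)).card
  have hN (n : ℕ) : Measurable (N n) := by
    have h1 : N n = fun F => ∑ c : Fin n → Bool,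
        ((voidEvent (C ∩ cell n ⁻¹' {c}))ᶜ).indicator (fun _ => 1) F := by
      funext F
      simp only [Set.indicator_apply, Finset.sum_boole, N, Nat.cast_id]
      congr 1
      ext c
      simp [voidEvent, and_assoc]
    rw [h1]
    exact Finset.measurable_sum _ fun c _ => measurable_const.indicator
      (measurableSet_voidEvent (hC.inter (hcell n (measurableSet_singleton c)))).compl
  refine measurable_of_tendsto_metrizable hN (tendsto_pi_nhds.2 fun F => ?_)
  -- Once all points of `F` lie in different cells, the cell count is exact.
  have h2 : ∀ᶠ n in Filter.atTop, ∀ x ∈ F.pts, ∀ y ∈ F.pts, cell n x = cell n y → x = y := by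
    refine (Filter.eventually_all_finset _).2 fun x _ => (Filter.eventually_all_finset _).2
      fun y _ => ?_
    by_cases hxy : x = y
    · exact Filter.Eventually.of_forall fun _ _ => hxy
    · obtain ⟨i, hi⟩ := Function.ne_iff.1 (hinj.ne hxy)
      filter_upwards [Filter.eventually_gt_atTop i] with n hn h
      exact absurd (congrFun h ⟨i, hn⟩) hi
  refine tendsto_const_nhds.congr' ?_
  filter_upwards [h2] with n hn
  refine (Finset.card_image_of_injOn ?_).symm
  intro x hx y hy h
  simp only [Finset.coe_filter, Set.mem_ofPred_eq] at hx hy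
  exact hn x hx.1 y hy.1 h

open scoped Classical in
/-- Point products `∏_{x ∈ F} g x` are measurable functions of the finite set `F`. -/
lemma measurable_prod_pts [MeasurableSpace.CountablySeparated E] {g : E → ℝ≥0∞}
    (hg : Measurable g) (hg_top : ∀ x, g x ≠ ∞) :
    Measurable fun F : FinSub E => ∏ x ∈ F.pts, g x := by
  refine measurable_of_tendsto_metrizable
    (f := fun n (F : FinSub E) => ∏ x ∈ F.pts, SimpleFunc.eapprox g n x) (fun n => ?_)
    (tendsto_pi_nhds.2 fun F => ?_)
  · set s := SimpleFunc.eapprox g n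
    have h1 : (fun F : FinSub E => ∏ x ∈ F.pts, s x) =
        fun F => ∏ v ∈ s.range, v ^ (F.pts.filter (· ∈ s ⁻¹' {v})).card := by
      funext F
      rw [← Finset.prod_fiberwise_of_maps_to (t := s.range) (g := s)
        (fun x _ => s.mem_range_self x)]
      refine Finset.prod_congr rfl fun v _ => ?_
      rw [Finset.prod_congr rfl (g := fun _ => v) (by simp), Finset.prod_const]
      congr!
    rw [h1]
    exact Finset.measurable_prod _ fun v _ =>
      (Measurable.of_discrete (f := fun m : ℕ => v ^ m)).comp
        (measurable_count (s.measurableSet_fiber v))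
  · refine ENNReal.tendsto_finsetProd_of_ne_top _ (fun x _ => ?_) fun x _ => hg_top x
    rw [← SimpleFunc.iSup_eapprox_apply hg x]
    exact tendsto_atTop_iSup fun a b hab => SimpleFunc.monotone_eapprox g hab x

end Void

/-! ### Measures with a multi-object density -/

section Density

variable {E : Type*} [MeasurableSpace E]

/-- The distribution on finite sets with multi-object density `g`. -/
noncomputable def setMeasure (ν : Measure E) (g : FinSub E → ℝ≥0∞) : Measure (FinSub E) :=
  Measure.sum fun n : ℕ => ((n.factorial : ℝ≥0∞))⁻¹ •
    ((Measure.pi fun _ : Fin n => ν).withDensity fun x => g (tupleSet x)).map tupleSet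

lemma setMeasure_apply (ν : Measure E) (g : FinSub E → ℝ≥0∞) {A : Set (FinSub E)}
    (hA : MeasurableSet A) : setMeasure ν g A = setIntegral ν (A.indicator g) := by
  rw [setMeasure, Measure.sum_apply _ hA, setIntegral]
  congr 1 with n
  rw [Measure.smul_apply, smul_eq_mul, Measure.map_apply (measurable_tupleSet n) hA,
    withDensity_apply _ (measurable_tupleSet n hA),
    ← lintegral_indicator (measurable_tupleSet n hA)]
  rfl

lemma hasSetDensity_iff {ν : Measure E} {P : Measure (FinSub E)} {g : FinSub E → ℝ≥0∞} :
    HasSetDensity ν P g ↔ P = setMeasure ν g := by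
  refine ⟨fun h => Measure.ext fun A hA => ?_, ?_⟩
  · rw [h A hA, setMeasure_apply ν g hA]
  · rintro rfl A hA
    exact setMeasure_apply ν g hA

/-- The expectation of `φ` under the density `g` is a set integral. Only measurability of `g` along
tuples is required, which is available almost everywhere for multi-Bernoulli densities. -/
lemma lintegral_setMeasure {ν : Measure E} {g φ : FinSub E → ℝ≥0∞}
    (hg : ∀ n, AEMeasurable (fun x : Fin n → E => g (tupleSet x)) (Measure.pi fun _ => ν))
    (hφ : Measurable φ) :
    ∫⁻ F, φ F ∂(setMeasure ν g) = setIntegral ν fun F => g F * φ F := by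
  rw [setMeasure, lintegral_sum_measure, setIntegral]
  congr 1 with n
  rw [lintegral_smul_measure, smul_eq_mul, lintegral_map hφ (measurable_tupleSet n),
    lintegral_withDensity_eq_lintegral_mul₀ (hg n)
      (g := fun x => φ (tupleSet x)) (hφ.comp (measurable_tupleSet n)).aemeasurable]
  rfl

end Density

/-! ### Unions of independent sets -/

section Union

variable {E : Type*} [MeasurableSpace E]

lemma bernoulliLaw_voidEvent (r : ℝ≥0∞) (μ : Measure E) {C : Set E} (hC : MeasurableSet C) :
    bernoulliLaw r μ (voidEvent C) = 1 - r + r * μ Cᶜ := by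
  rw [bernoulliLaw, Measure.add_apply, Measure.smul_apply, Measure.smul_apply,
    Measure.map_apply measurable_singleton_finSub (measurableSet_voidEvent hC),
    Measure.dirac_apply' _ (measurableSet_voidEvent hC)]
  have h1 : ((fun x : E => (⟨{x}⟩ : FinSub E)) ⁻¹' voidEvent C) = Cᶜ := by
    ext x
    simp [voidEvent]
  have h2 : (⟨∅⟩ : FinSub E) ∈ voidEvent C := by simp [voidEvent]
  rw [h1, Set.indicator_of_mem h2]
  simp

lemma isProbabilityMeasure_bernoulliLaw {r : ℝ≥0∞} {μ : Measure E} (hr : r ≤ 1)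
    (hμ : r ≠ 0 → μ Set.univ = 1) : IsProbabilityMeasure (bernoulliLaw r μ) := by
  refine ⟨?_⟩
  rw [← voidEvent_empty, bernoulliLaw_voidEvent r μ MeasurableSet.empty, Set.compl_empty]
  rcases eq_or_ne r 0 with rfl | h
  · simp
  · rw [hμ h, mul_one, tsub_add_cancel_of_le hr]

lemma unionLaw_voidEvent {ι : Type*} [Fintype ι] (P : ι → Measure (FinSub E))
    [∀ i, IsProbabilityMeasure (P i)] {C : Set E} (hC : MeasurableSet C) :
    unionLaw P (voidEvent C) = ∏ i, P i (voidEvent C) := by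
  classical
  have key (C : Set E) : (fun Y : ι → FinSub E =>
      (⟨Finset.univ.biUnion fun i => (Y i).pts⟩ : FinSub E)) ⁻¹' voidEvent C =
      Set.pi Set.univ fun _ => voidEvent C := by
    ext Y
    simp only [voidEvent, Set.mem_preimage, Set.mem_ofPred_eq, Finset.mem_biUnion,
      Finset.mem_univ, true_and, forall_exists_index, Set.mem_pi, Set.mem_univ, forall_const]
    exact forall_comm
  have hm : Measurable (fun Y : ι → FinSub E =>
      (⟨Finset.univ.biUnion fun i => (Y i).pts⟩ : FinSub E)) :=
    measurable_of_voidEvent fun C hC => by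
      rw [key]
      exact MeasurableSet.univ_pi fun _ => measurableSet_voidEvent hC
  rw [← Measure.pi_pi, ← key, unionLaw]
  convert Measure.map_apply hm (measurableSet_voidEvent hC)

lemma isProbabilityMeasure_unionLaw {ι : Type*} [Fintype ι] (P : ι → Measure (FinSub E))
    [∀ i, IsProbabilityMeasure (P i)] : IsProbabilityMeasure (unionLaw P) := by
  refine ⟨?_⟩
  rw [← voidEvent_empty, unionLaw_voidEvent P MeasurableSet.empty, voidEvent_empty]
  simp

lemma unionLaw₂_voidEvent (P Q : Measure (FinSub E)) [IsProbabilityMeasure P]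
    [IsProbabilityMeasure Q] {C : Set E} (hC : MeasurableSet C) :
    unionLaw₂ P Q (voidEvent C) = P (voidEvent C) * Q (voidEvent C) := by
  classical
  have key (C : Set E) : (fun Y : FinSub E × FinSub E => (⟨Y.1.pts ∪ Y.2.pts⟩ : FinSub E)) ⁻¹'
      voidEvent C = voidEvent C ×ˢ voidEvent C := by
    ext Y
    simp only [voidEvent, Set.mem_preimage, Set.mem_ofPred_eq, Finset.mem_union, or_imp,
      forall_and, Set.mem_prod]
  have hm : Measurable (fun Y : FinSub E × FinSub E => (⟨Y.1.pts ∪ Y.2.pts⟩ : FinSub E)) :=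
    measurable_of_voidEvent fun C hC => by
      rw [key]
      exact (measurableSet_voidEvent hC).prod (measurableSet_voidEvent hC)
  rw [← Measure.prod_prod, ← key, unionLaw₂]
  convert Measure.map_apply hm (measurableSet_voidEvent hC)

lemma isProbabilityMeasure_unionLaw₂ (P Q : Measure (FinSub E)) [IsProbabilityMeasure P]
    [IsProbabilityMeasure Q] : IsProbabilityMeasure (unionLaw₂ P Q) := by
  refine ⟨?_⟩
  rw [← voidEvent_empty, unionLaw₂_voidEvent P Q MeasurableSet.empty, voidEvent_empty]
  simp

end Union

/-! ### Tuples under an atomless product measure -/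

section Tuples

variable {E : Type*} [MeasurableSpace E]

/-- Under an atomless reference measure almost every tuple has distinct entries. -/
lemma ae_injective [MeasurableSpace.CountablySeparated E] (ν : Measure E) [SigmaFinite ν]
    [NullSingletonClass ν] (m : ℕ) :
    ∀ᵐ x ∂(Measure.pi fun _ : Fin m => ν), Function.Injective x := by
  obtain ⟨φ, hφ, hinj⟩ := MeasurableSpace.measurable_injection_nat_bool_of_countablySeparated E
  have h1 : ∀ i j : Fin m, i ≠ j → ∀ᵐ x ∂(Measure.pi fun _ : Fin m => ν), x i ≠ x j := by
    intro i j hij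
    cases m with
    | zero => exact i.elim0
    | succ m =>
      obtain ⟨j, rfl⟩ := Fin.exists_succAbove_eq hij.symm
      have hmeas : MeasurableSet {p : E × (Fin m → E) | p.1 = p.2 j} := by
        have : {p : E × (Fin m → E) | p.1 = p.2 j} = {p | φ p.1 = φ (p.2 j)} := by
          ext p
          exact hinj.eq_iff.symm
        rw [this]
        exact measurableSet_eq_fun (hφ.comp measurable_fst)
          (hφ.comp ((measurable_pi_apply j).comp measurable_snd))
      have hmp := measurePreserving_piFinSuccAbove (fun _ : Fin (m + 1) => ν) i
      have h0 := hmp.measure_preimage hmeas.nullMeasurableSet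
      rw [(Measure.measure_prod_null hmeas).2 (Filter.Eventually.of_forall fun a => ?_)] at h0
      · rw [ae_iff]
        simp only [not_not]
        exact h0
      · have := Measure.pi_hyperplane (fun _ : Fin m => ν) j a
        simp only [Set.preimage_ofPred_eq, eq_comm (a := a)]
        exact this
  have h2 : ∀ᵐ x ∂(Measure.pi fun _ : Fin m => ν), ∀ i j : Fin m, i ≠ j → x i ≠ x j := by
    simp only [ae_all_iff]
    exact h1
  filter_upwards [h2] with x hx i j h
  by_contra hij
  exact hx i j hij h

lemma lintegral_pi_prod (ν : Measure E) [SigmaFinite ν] :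
    ∀ {m : ℕ} (g : Fin m → E → ℝ≥0∞) (_ : ∀ j, Measurable (g j)),
      ∫⁻ x, ∏ j, g j (x j) ∂(Measure.pi fun _ : Fin m => ν) = ∏ j, ∫⁻ y, g j y ∂ν
  | 0, g, _ => by simp
  | m + 1, g, hg => by
    have hmp := (measurePreserving_piFinSuccAbove (fun _ : Fin (m + 1) => ν) 0)
    have hm : Measurable fun y : Fin m → E => ∏ j, g j.succ (y j) :=
      Finset.measurable_prod _ fun j _ => (hg _).comp (measurable_pi_apply j)
    rw [Fin.prod_univ_succ, ← lintegral_pi_prod ν (fun j => g j.succ) fun j => hg _,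
      ← lintegral_prod_mul (hg 0).aemeasurable hm.aemeasurable,
      ← hmp.lintegral_comp (f := fun p => g 0 p.1 * ∏ j, g j.succ (p.2 j))
        (((hg 0).comp measurable_fst).mul (hm.comp measurable_snd))]
    refine lintegral_congr fun x => ?_
    rw [Fin.prod_univ_succ]
    rfl

end Tuples

/-! ### Assignments of points to tracks -/

section Combinatorics

lemma mem_orderedPartitions {E : Type*} {n : ℕ} {X : Finset E} {Y : Fin n → Finset E} :
    Y ∈ orderedPartitions n X ↔ (∀ i, Y i ⊆ X) ∧ (∀ i j, i ≠ j → Disjoint (Y i) (Y j)) ∧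
      ∀ a, a ∈ X ↔ ∃ i, a ∈ Y i := by
  classical
  rw [orderedPartitions, Finset.mem_filter, Fintype.mem_piFinset]
  simp only [Finset.mem_powerset, Finset.ext_iff, Finset.mem_biUnion, Finset.mem_univ, true_and,
    eq_comm]

open scoped Classical in
/-- The ordered partitions of a set of `m` labelled points into `n` blocks correspond to the maps
that assign to every point its block. -/
lemma sum_orderedPartitions_tupleSet {E M : Type*} [CommSemiring M] {m n : ℕ} {x : Fin m → E}
    (hx : Function.Injective x) (T : Fin n → Finset E → M) :
    ∑ Y ∈ orderedPartitions n (tupleSet x).pts, ∏ i, T i (Y i) =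
      ∑ σ : Fin m → Fin n, ∏ i, T i ((Finset.univ.filter (σ · = i)).image x) := by
  symm
  refine Finset.sum_bij (fun σ _ i => (Finset.univ.filter (σ · = i)).image x) ?_ ?_ ?_ ?_
  · intro σ _
    rw [mem_orderedPartitions]
    refine ⟨fun i => Finset.image_subset_image (Finset.filter_subset _ _), ?_, ?_⟩
    · intro i j hij
      rw [Finset.disjoint_image hx, Finset.disjoint_filter]
      rintro a - rfl
      exact hij
    · intro a
      simp [tupleSet]
  · intro σ _ τ _ h
    funext j
    have h1 := congrFun h (σ j)
    have h2 : x j ∈ (Finset.univ.filter (τ · = σ j)).image x := by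
      rw [← h1]
      exact Finset.mem_image_of_mem _ (by simp)
    rw [Finset.mem_image] at h2
    obtain ⟨j', hj', he⟩ := h2
    rw [hx he] at hj'
    exact (Finset.mem_filter.1 hj').2.symm
  · intro Y hY
    rw [mem_orderedPartitions] at hY
    obtain ⟨hsub, hdisj, hun⟩ := hY
    have hex (j : Fin m) : ∃ i, x j ∈ Y i :=
      (hun _).1 (Finset.mem_image_of_mem _ (Finset.mem_univ _))
    choose σ hσ using hex
    refine ⟨σ, Finset.mem_univ _, ?_⟩
    funext i
    ext a
    simp only [Finset.mem_image, Finset.mem_filter, Finset.mem_univ, true_and]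
    constructor
    · rintro ⟨j, rfl, rfl⟩
      exact hσ j
    · intro ha
      obtain ⟨j, -, rfl⟩ := Finset.mem_image.1 (hsub i ha)
      refine ⟨j, ?_, rfl⟩
      by_contra hne
      exact Finset.disjoint_left.1 (hdisj _ _ hne) (hσ j) ha
  · intro σ _
    rfl

open scoped Classical in
/-- A product of Bernoulli densities vanishes unless every block has at most one point. -/
lemma prod_bernoulliDensity_fiber {E : Type*} {m n : ℕ} {x : Fin m → E}
    (hx : Function.Injective x) (r : Fin n → ℝ≥0∞) (f : Fin n → E → ℝ≥0∞) (σ : Fin m → Fin n) :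
    ∏ i, bernoulliDensity (r i) (f i) ((Finset.univ.filter (σ · = i)).image x) =
      if Function.Injective σ then
        (∏ i ∈ Finset.univ \ Finset.univ.image σ, (1 - r i)) * ∏ j, r (σ j) * f (σ j) (x j)
      else 0 := by
  split_ifs with hσ
  · rw [← Finset.prod_sdiff (Finset.subset_univ (Finset.univ.image σ)),
      Finset.prod_image hσ.injOn]
    congr 1
    · refine Finset.prod_congr rfl fun i hi => ?_
      have : Finset.univ.filter (σ · = i) = ∅ := by
        simpa [Finset.filter_eq_empty_iff] using hi
      rw [this, Finset.image_empty, bernoulliDensity, if_pos rfl]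
    · refine Finset.prod_congr rfl fun j _ => ?_
      have : Finset.univ.filter (σ · = σ j) = {j} := by
        ext j'
        simp [hσ.eq_iff]
      rw [this, Finset.image_singleton, bernoulliDensity, if_neg (Finset.singleton_ne_empty _),
        if_pos (Finset.card_singleton _), Finset.prod_singleton]
  · simp only [Function.Injective, not_forall] at hσ
    obtain ⟨a, b, hab, hne⟩ := hσ
    refine Finset.prod_eq_zero (Finset.mem_univ (σ b)) ?_
    have h2 : 1 < ((Finset.univ.filter (σ · = σ b)).image x).card :=
      Finset.one_lt_card.2 ⟨x a, Finset.mem_image_of_mem _ (by simp [hab]), x b,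
        Finset.mem_image_of_mem _ (by simp), hx.ne hne⟩
    rw [bernoulliDensity, if_neg, if_neg h2.ne']
    intro h
    simp [h] at h2

open scoped Classical in
/-- Every `m`-element set is the image of exactly `m!` injections of `Fin m`. -/
lemma sum_injective_image {M : Type*} [CommSemiring M] {m n : ℕ} (T : Finset (Fin n) → M) :
    ∑ σ : Fin m → Fin n, (if Function.Injective σ then T (Finset.univ.image σ) else 0) =
      (m.factorial : M) * ∑ S ∈ Finset.univ.powersetCard m, T S := by
  rw [← Finset.sum_filter, Finset.mul_sum,
    ← Finset.sum_fiberwise_of_maps_to (t := Finset.univ.powersetCard m)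
      (g := fun σ : Fin m → Fin n => Finset.univ.image σ)]
  · refine Finset.sum_congr rfl fun S hS => ?_
    rw [Finset.sum_congr rfl (g := fun _ => T S), Finset.sum_const, nsmul_eq_mul]
    · congr 2
      have hc : S.card = m := (Finset.mem_powersetCard.1 hS).2
      have e : Fin m ≃ S := (S.equivFinOfCardEq hc).symm
      have h1 := Fintype.card_equiv e
      rw [Fintype.card_fin] at h1
      rw [← h1, ← Finset.card_univ]
      symm
      refine Finset.card_bij (fun (e : Fin m ≃ S) _ j => (e j : Fin n)) ?_ ?_ ?_
      · intro e _
        simp only [Finset.mem_filter, Finset.mem_univ, true_and]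
        refine ⟨Subtype.val_injective.comp e.injective, ?_⟩
        ext i
        simp only [Finset.mem_image, Finset.mem_univ, true_and]
        exact ⟨by rintro ⟨j, rfl⟩; exact (e j).2, fun hi => ⟨e.symm ⟨i, hi⟩, by simp⟩⟩
      · intro e _ e' _ h
        ext j
        exact congrArg Fin.val (congrFun h j)
      · intro σ hσ
        simp only [Finset.mem_filter, Finset.mem_univ, true_and] at hσ
        obtain ⟨hinj, him⟩ := hσ
        have hmem (j : Fin m) : σ j ∈ S := by
          rw [← him]
          exact Finset.mem_image_of_mem _ (Finset.mem_univ _)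
        refine ⟨Equiv.ofBijective (fun j => ⟨σ j, hmem j⟩) ⟨?_, ?_⟩, Finset.mem_univ _, rfl⟩
        · intro a b h
          exact hinj (congrArg Subtype.val h)
        · rintro ⟨i, hi⟩
          rw [← him, Finset.mem_image] at hi
          obtain ⟨j, -, rfl⟩ := hi
          exact ⟨j, rfl⟩
    · intro σ hσ
      rw [(Finset.mem_filter.1 hσ).2]
  · intro σ hσ
    rw [Finset.mem_powersetCard]
    exact ⟨Finset.subset_univ _, by
      rw [Finset.card_image_of_injective _ (Finset.mem_filter.1 hσ).2, Finset.card_univ,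
        Fintype.card_fin]⟩

end Combinatorics

/-! ### The probability generating functional of a multi-Bernoulli density -/

section Pgfl

variable {E : Type*} [MeasurableSpace E]

/-- The multi-Bernoulli density: the convolution of `n` Bernoulli densities. -/
noncomputable def multiBernoulliDensity {n : ℕ} (r : Fin n → ℝ≥0∞) (f : Fin n → E → ℝ≥0∞)
    (F : FinSub E) : ℝ≥0∞ :=
  ∑ Y ∈ orderedPartitions n F.pts, ∏ i, bernoulliDensity (r i) (f i) (Y i)

variable [MeasurableSpace.CountablySeparated E] (ν : Measure E) [SigmaFinite ν]
  [NullSingletonClass ν] {n : ℕ} {r : Fin n → ℝ≥0∞} {f : Fin n → E → ℝ≥0∞}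

open scoped Classical in
lemma multiBernoulliDensity_tupleSet_ae (m : ℕ) (r : Fin n → ℝ≥0∞) (f : Fin n → E → ℝ≥0∞) :
    (fun x : Fin m → E => multiBernoulliDensity r f (tupleSet x)) =ᵐ[Measure.pi fun _ => ν]
      fun x => ∑ σ : Fin m → Fin n, if Function.Injective σ then
        (∏ i ∈ Finset.univ \ Finset.univ.image σ, (1 - r i)) * ∏ j, r (σ j) * f (σ j) (x j)
      else 0 := by
  filter_upwards [ae_injective ν m] with x hx
  rw [multiBernoulliDensity,
    sum_orderedPartitions_tupleSet hx fun i => bernoulliDensity (r i) (f i)]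
  exact Finset.sum_congr rfl fun σ _ => prod_bernoulliDensity_fiber hx r f σ

lemma aemeasurable_multiBernoulliDensity (m : ℕ) (hf : ∀ i, Measurable (f i)) :
    AEMeasurable (fun x : Fin m → E => multiBernoulliDensity r f (tupleSet x))
      (Measure.pi fun _ => ν) := by
  classical
  refine AEMeasurable.congr (Measurable.aemeasurable ?_)
    (multiBernoulliDensity_tupleSet_ae ν m r f).symm
  refine Finset.measurable_sum _ fun σ _ => ?_
  split_ifs
  · exact (Finset.measurable_prod _ fun j _ =>
      ((hf _).comp (measurable_pi_apply j)).const_mul _).const_mul _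
  · exact measurable_const

/-- The probability generating functional of a multi-Bernoulli density is the product of those of
the Bernoulli densities. -/
lemma setIntegral_multiBernoulliDensity_mul_prod (hf : ∀ i, Measurable (f i)) {h : E → ℝ≥0∞}
    (hh : Measurable h) :
    setIntegral ν (fun F => multiBernoulliDensity r f F * ∏ x ∈ F.pts, h x) =
      ∏ i, (1 - r i + r i * ∫⁻ x, f i x * h x ∂ν) := by
  classical
  let I (i : Fin n) : ℝ≥0∞ := r i * ∫⁻ x, f i x * h x ∂ν
  let T (S : Finset (Fin n)) : ℝ≥0∞ := (∏ i ∈ Finset.univ \ S, (1 - r i)) * ∏ i ∈ S, I i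
  have hterm (m : ℕ) : ∫⁻ x : Fin m → E, multiBernoulliDensity r f (tupleSet x) *
      ∏ y ∈ (tupleSet x).pts, h y ∂(Measure.pi fun _ => ν) =
      (m.factorial : ℝ≥0∞) * ∑ S ∈ Finset.univ.powersetCard m, T S := by
    have hg (i : Fin n) : Measurable fun y => r i * (f i y * h y) := ((hf i).mul hh).const_mul _
    have h1 : (fun x : Fin m → E => multiBernoulliDensity r f (tupleSet x) *
        ∏ y ∈ (tupleSet x).pts, h y) =ᵐ[Measure.pi fun _ => ν]
        fun x => ∑ σ : Fin m → Fin n, if Function.Injective σ then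
          (∏ i ∈ Finset.univ \ Finset.univ.image σ, (1 - r i)) *
            ∏ j, r (σ j) * (f (σ j) (x j) * h (x j)) else 0 := by
      filter_upwards [ae_injective ν m, multiBernoulliDensity_tupleSet_ae ν m r f] with x hx hx'
      have h2 : ∏ y ∈ (tupleSet x).pts, h y = ∏ j, h (x j) := Finset.prod_image hx.injOn
      rw [hx', h2, Finset.sum_mul]
      refine Finset.sum_congr rfl fun σ _ => ?_
      split_ifs
      · rw [mul_assoc, ← Finset.prod_mul_distrib]
        simp only [mul_assoc]
      · rw [zero_mul]
    have hm (σ : Fin m → Fin n) :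
        Measurable fun x : Fin m → E => ∏ j, r (σ j) * (f (σ j) (x j) * h (x j)) :=
      Finset.measurable_prod _ fun j _ => (hg (σ j)).comp (measurable_pi_apply j)
    rw [lintegral_congr_ae h1, ← sum_injective_image, lintegral_finsetSum]
    · refine Finset.sum_congr rfl fun σ _ => ?_
      split_ifs with hσ
      · rw [lintegral_const_mul _ (hm σ),
          lintegral_pi_prod ν (fun j y => r (σ j) * (f (σ j) y * h y)) fun j => hg (σ j)]
        simp only [T, I, Finset.prod_image hσ.injOn]
        congr 1
        exact Finset.prod_congr rfl fun j _ => lintegral_const_mul _ ((hf _).mul hh)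
      · exact lintegral_zero
    · intro σ _
      split_ifs
      · exact (hm σ).const_mul _
      · exact measurable_const
  have hterm' (m : ℕ) : ((m.factorial : ℝ≥0∞))⁻¹ * ∫⁻ x : Fin m → E,
      multiBernoulliDensity r f (tupleSet x) *
        ∏ y ∈ (tupleSet x).pts, h y ∂(Measure.pi fun _ => ν) =
      ∑ S ∈ Finset.univ.powersetCard m, T S := by
    rw [hterm, ← mul_assoc, ENNReal.inv_mul_cancel (by exact_mod_cast m.factorial_ne_zero)
      (ENNReal.natCast_ne_top _), one_mul]
  have hsplit : ∏ i, (1 - r i + I i) = ∑ S ∈ Finset.univ.powerset, T S := by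
    simp only [add_comm (1 - r _)]
    rw [Finset.prod_add]
    exact Finset.sum_congr rfl fun S _ => mul_comm _ _
  rw [setIntegral, tsum_congr hterm', hsplit, Finset.sum_powerset]
  refine tsum_eq_sum fun m hm => ?_
  rw [Finset.powersetCard_eq_empty.2, Finset.sum_empty]
  simpa using hm

end Pgfl

/-! ### Measurability on disjoint unions -/

section Sigma

variable {ι : Type*} {β : ι → Type*} [∀ i, MeasurableSpace (β i)]

lemma measurableSet_sigma_iff {s : Set (Sigma β)} :
    MeasurableSet s ↔ ∀ i, MeasurableSet (Sigma.mk i ⁻¹' s) :=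
  MeasurableSpace.measurableSet_iInf

lemma measurable_sigma {γ : Type*} [MeasurableSpace γ] {f : Sigma β → γ}
    (h : ∀ i, Measurable fun x => f ⟨i, x⟩) : Measurable f :=
  fun _ hs => measurableSet_sigma_iff.2 fun i => h i hs

lemma measurableEmbedding_sigmaMk (i : ι) : MeasurableEmbedding (Sigma.mk i : β i → Sigma β) where
  injective := sigma_mk_injective
  measurable := fun _ hs => measurableSet_sigma_iff.1 hs i
  measurableSet_image' := fun s hs => measurableSet_sigma_iff.2 fun j => by
    by_cases h : i = j
    · subst h
      rwa [Set.preimage_image_eq _ sigma_mk_injective]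
    · rw [Set.preimage_image_sigmaMk_of_ne (Ne.symm h)]
      exact MeasurableSet.empty

lemma measurable_sigma_prod [Countable ι] {γ δ : Type*} [MeasurableSpace γ] [MeasurableSpace δ]
    {f : Sigma β × γ → δ} (h : ∀ i, Measurable fun p : β i × γ => f (⟨i, p.1⟩, p.2)) :
    Measurable f := by
  intro s hs
  have : f ⁻¹' s = ⋃ i, Prod.map (Sigma.mk i) id ''
      ((fun p : β i × γ => f (⟨i, p.1⟩, p.2)) ⁻¹' s) := by
    ext ⟨⟨i, x⟩, y⟩
    simp only [Set.mem_preimage, Set.mem_iUnion, Set.mem_image, Prod.exists, Prod.map_apply, id_eq]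
    constructor
    · exact fun h => ⟨i, x, y, h, rfl⟩
    · rintro ⟨_, _, _, h, he⟩
      rwa [he] at h
  rw [this]
  exact MeasurableSet.iUnion fun i =>
    (((measurableEmbedding_sigmaMk i).prodMap MeasurableEmbedding.id).measurableSet_image).2
      (h i hs)

lemma countablySeparated_of_injective {α γ : Type*} [MeasurableSpace α] [MeasurableSpace γ]
    [MeasurableSpace.CountablySeparated γ] {f : α → γ} (hf : Measurable f)
    (hinj : Function.Injective f) : MeasurableSpace.CountablySeparated α := by
  obtain ⟨S, hc, hS, hsep⟩ := MeasurableSpace.CountablySeparated.countably_separated (α := γ)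
  refine ⟨⟨(f ⁻¹' ·) '' S, hc.image _, ?_, fun x _ y _ hxy => hinj ?_⟩⟩
  · rintro _ ⟨s, hs, rfl⟩
    exact hf (hS s hs)
  · exact hsep _ trivial _ trivial fun s hs => hxy _ ⟨s, hs, rfl⟩

instance countablySeparated_sigma [Countable ι] [∀ i, MeasurableSpace.CountablySeparated (β i)] :
    MeasurableSpace.CountablySeparated (Sigma β) := by
  obtain ⟨e, he⟩ := exists_injective_nat ι
  choose φ hφ hinj using fun i =>
    MeasurableSpace.measurable_injection_nat_bool_of_countablySeparated (β i)
  refine countablySeparated_of_injective (f := fun X : Sigma β => (e X.1, φ X.1 X.2))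
    (measurable_sigma fun i => (measurable_const (a := e i)).prodMk (hφ i)) ?_
  rintro ⟨i, x⟩ ⟨j, y⟩ h
  simp only [Prod.mk.injEq] at h
  obtain rfl := he h.1
  rw [hinj i h.2]

end Sigma

/-! ### The trajectory space and the transition of one trajectory -/

section Traj

variable {d k : ℕ}

instance finite_timeIndices :
    Finite {I : ℕ × ℕ // I.1 ≤ I.2 ∧ I.2 ≤ k} :=
  Set.Finite.to_subtype (((Set.finite_Iic k).prod (Set.finite_Iic k)).subset
    fun _ hI => ⟨hI.1.trans hI.2, hI.2⟩)

instance sigmaFinite_trajMeasure : SigmaFinite (trajMeasure d k) := by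
  have (I : {I : ℕ × ℕ // I.1 ≤ I.2 ∧ I.2 ≤ k}) := (measurableEmbedding_sigmaMk
    (β := fun I : {I : ℕ × ℕ // I.1 ≤ I.2 ∧ I.2 ≤ k} =>
      Fin (I.1.2 - I.1.1 + 1) → State d) I).sigmaFinite_map (μ := volume)
  exact sum.sigmaFinite _

lemma lintegral_trajMeasure (g : Traj d k → ℝ≥0∞) :
    ∫⁻ X, g X ∂(trajMeasure d k) =
      ∑' I : {I : ℕ × ℕ // I.1 ≤ I.2 ∧ I.2 ≤ k}, ∫⁻ x, g ⟨I, x⟩ := by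
  rw [trajMeasure, lintegral_sum_measure]
  exact tsum_congr fun I => (measurableEmbedding_sigmaMk
    (β := fun I : {I : ℕ × ℕ // I.1 ≤ I.2 ∧ I.2 ≤ k} =>
      Fin (I.1.2 - I.1.1 + 1) → State d) I).lintegral_map _

lemma nullSingletonClass_trajMeasure (hd : 0 < d) : NullSingletonClass (trajMeasure d k) := by
  have : Nonempty (Fin d) := ⟨⟨0, hd⟩⟩
  have : NullSingletonClass (volume : Measure (State d)) := inferInstance
  have (N : ℕ) : NullSingletonClass (volume : Measure (Fin (N + 1) → State d)) :=
    Measure.pi_nullSingletonClass 0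
  refine ⟨fun X => ?_⟩
  rw [trajMeasure, Measure.sum_apply_eq_zero]
  intro I
  have hemb := measurableEmbedding_sigmaMk
    (β := fun I : {I : ℕ × ℕ // I.1 ≤ I.2 ∧ I.2 ≤ k} => Fin (I.1.2 - I.1.1 + 1) → State d) I
  rw [hemb.map_apply]
  exact (Set.subsingleton_singleton.preimage hemb.injective).measure_zero _

namespace Traj

lemma measurable_last : Measurable (last : Traj d k → State d) :=
  measurable_sigma fun I => measurable_pi_apply (Fin.last (I.1.2 - I.1.1))

lemma measurable_mk {α : Type*} [MeasurableSpace α] (I : {I : ℕ × ℕ // I.1 ≤ I.2 ∧ I.2 ≤ k})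
    {g : α → Fin (I.1.2 - I.1.1 + 1) → State d} (hg : ∀ j, Measurable fun a => g a j) :
    Measurable fun a => (⟨I, g a⟩ : Traj d k) :=
  (measurableEmbedding_sigmaMk (β := fun I : {I : ℕ × ℕ // I.1 ≤ I.2 ∧ I.2 ≤ k} =>
    Fin (I.1.2 - I.1.1 + 1) → State d) I).measurable.comp (measurable_pi_lambda _ hg)

lemma measurable_extend :
    Measurable fun p : Traj d k × State d => p.1.extend p.2 := by
  refine measurable_sigma_prod fun I => ?_
  refine measurable_mk ⟨(I.1.1, I.1.2 + 1), Nat.le_succ_of_le I.2.1, Nat.succ_le_succ I.2.2⟩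
    (g := fun (p : (Fin (I.1.2 - I.1.1 + 1) → State d) × State d) j =>
      if h : j.val < I.1.2 - I.1.1 + 1 then p.1 ⟨j.val, h⟩ else p.2) fun j => ?_
  by_cases h : j.val < I.1.2 - I.1.1 + 1
  · simp only [h, dite_true]
    exact (measurable_pi_apply _).comp measurable_fst
  · simp only [h, dite_false]
    exact measurable_snd

lemma parent_extend (X : Traj d k) (y : State d) (h) : (X.extend y).parent h = X := by
  refine Sigma.ext rfl (heq_of_eq (funext fun j => ?_))
  exact dif_pos j.2

lemma last_extend (X : Traj d k) (y : State d) : (X.extend y).last = y := by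
  refine dif_neg ?_
  have h1 := X.1.2.1
  simp only [Fin.val_last, extend]
  omega

end Traj

/-- Appending one coordinate to a tuple preserves volume. The length `N` is a variable because the
number of states `ε + 1 - β + 1` is only propositionally equal to `(ε - β + 1) + 1`. -/
lemma measurePreserving_append {S : Type*} [MeasureSpace S] [SigmaFinite (volume : Measure S)]
    {M N : ℕ} (h : N = M + 1) :
    MeasurePreserving (fun (p : (Fin M → S) × S) (j : Fin N) =>
      if h : j.val < M then p.1 ⟨j.val, h⟩ else p.2) (volume.prod volume) volume := by
  subst h
  have h1 := (volume_preserving_piFinSuccAbove (fun _ : Fin (M + 1) => S) (Fin.last M)).symm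
  have h2 := h1.comp (Measure.measurePreserving_swap (μ := volume) (ν := volume))
  refine (congrArg (fun φ => MeasurePreserving φ (volume.prod volume) volume) ?_).mp h2
  funext p j
  refine Fin.lastCases ?_ (fun j => ?_) j
  · simp [MeasurableEquiv.piFinSuccAbove]
  · simp [MeasurableEquiv.piFinSuccAbove]

/-- A trajectory of length at least two is the extension of its parent by its last state, so that
the reference measure splits on such trajectories. -/
lemma lintegral_trajMeasure_succ {G : Traj d (k + 1) → ℝ≥0∞} (hG : Measurable G)
    (h0 : ∀ X : Traj d (k + 1), ¬ X.1.1.1 < X.1.1.2 → G X = 0) :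
    ∫⁻ X, G X ∂(trajMeasure d (k + 1)) =
      ∫⁻ X', (∫⁻ y, G (X'.extend y)) ∂(trajMeasure d k) := by
  rw [lintegral_trajMeasure, lintegral_trajMeasure]
  let e (I : {I : ℕ × ℕ // I.1 ≤ I.2 ∧ I.2 ≤ k}) : {I : ℕ × ℕ // I.1 ≤ I.2 ∧ I.2 ≤ k + 1} :=
    ⟨(I.1.1, I.1.2 + 1), Nat.le_succ_of_le I.2.1, Nat.succ_le_succ I.2.2⟩
  have he : Function.Injective e := by
    intro I J h
    have h1 := congrArg Subtype.val h
    simp only [e, Prod.mk.injEq, Nat.add_right_cancel_iff] at h1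
    exact Subtype.ext (Prod.ext h1.1 h1.2)
  rw [← he.tsum_eq]
  · refine tsum_congr fun I => ?_
    have hN : I.1.2 + 1 - I.1.1 + 1 = I.1.2 - I.1.1 + 1 + 1 := by
      have := I.2.1
      omega
    have hGI : Measurable fun x => G ⟨e I, x⟩ := hG.comp (measurableEmbedding_sigmaMk _).measurable
    have h2 := measurePreserving_append (S := State d) hN
    refine (h2.lintegral_comp hGI).symm.trans ?_
    exact lintegral_prod _ (hGI.comp h2.measurable).aemeasurable
  · intro J hJ
    by_contra hne
    refine hJ ?_
    have hlt : ¬ J.1.1 < J.1.2 := by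
      intro hlt
      refine hne ⟨⟨(J.1.1, J.1.2 - 1), Nat.le_sub_one_of_lt hlt,
        Nat.sub_le_of_le_add J.2.2⟩, Subtype.ext (Prod.ext rfl ?_)⟩
      simp only [e]
      omega
    simp [h0 ⟨J, _⟩ hlt]

lemma measurable_survProb {PS : State d → ℝ≥0∞} (hPS : Measurable PS) :
    Measurable (survProb PS k) := by
  refine measurable_sigma fun I => ?_
  by_cases h : I.1.2 = k
  · simp only [survProb, Traj.endTime, h, if_true]
    exact hPS.comp (measurable_pi_apply (Fin.last (I.1.2 - I.1.1)))
  · simp only [survProb, Traj.endTime, h, if_false]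
    exact measurable_const

lemma survProb_le_one {PS : State d → ℝ≥0∞} (hPS : ∀ x, PS x ≤ 1) (X : Traj d k) :
    survProb PS k X ≤ 1 := by
  rw [survProb]
  split_ifs
  · exact hPS _
  · exact zero_le_one

lemma measurable_survTransInner {PS : State d → ℝ≥0∞} (hPS : Measurable PS)
    {π : State d → State d → ℝ≥0∞} (hπ : Measurable (Function.uncurry π))
    {f : Traj d k → ℝ≥0∞} (hf : Measurable f) : Measurable (survTransInner PS π f) := by
  refine measurable_sigma fun I => ?_
  by_cases h : I.1.1 < I.1.2
  · have hp : Measurable fun x => Traj.parent (⟨I, x⟩ : Traj d (k + 1)) h :=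
      Traj.measurable_mk ⟨(I.1.1, I.1.2 - 1), Nat.le_sub_one_of_lt h, Nat.sub_le_of_le_add I.2.2⟩
        (g := fun (x : Fin (I.1.2 - I.1.1 + 1) → State d) j => x ⟨j.val, lt_of_lt_of_le j.isLt
          (Nat.succ_le_succ (Nat.sub_le_sub_right (Nat.sub_le _ 1) _))⟩)
        fun j => measurable_pi_apply _
    simp only [survTransInner, h, dite_true]
    exact ((hf.comp hp).mul ((measurable_survProb hPS).comp hp)).mul
      (hπ.comp ((Traj.measurable_last.comp hp).prodMk
        (measurable_pi_apply (Fin.last (I.1.2 - I.1.1)))))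
  · simp only [survTransInner, h, dite_false]
    exact measurable_const

lemma survTransInner_extend (PS : State d → ℝ≥0∞) (π : State d → State d → ℝ≥0∞)
    (f : Traj d k → ℝ≥0∞) (X : Traj d k) (y : State d) :
    survTransInner PS π f (X.extend y) = f X * survProb PS k X * π X.last y := by
  have h : (X.extend y).1.1.1 < (X.extend y).1.1.2 := Nat.lt_succ_of_le X.1.2.1
  rw [survTransInner, dif_pos h, Traj.parent_extend, Traj.last_extend]

lemma survTransition_apply (π : State d → State d → ℝ≥0∞) (X : Traj d k)
    {C : Set (Traj d (k + 1))} (hC : MeasurableSet C) :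
    survTransition π X C = ∫⁻ y, π X.last y * C.indicator 1 (X.extend y) := by
  have hX : Measurable X.extend := Traj.measurable_extend.comp measurable_prodMk_left
  rw [survTransition, Measure.map_apply hX hC, withDensity_apply _ (hX hC),
    ← lintegral_indicator (hX hC)]
  refine lintegral_congr fun y => ?_
  by_cases h : X.extend y ∈ C
  · rw [Set.indicator_of_mem (by exact h), Set.indicator_of_mem h, Pi.one_apply, mul_one]
  · rw [Set.indicator_of_notMem (by exact h), Set.indicator_of_notMem h, mul_zero]

lemma measurable_survTransition {π : State d → State d → ℝ≥0∞}
    (hπ : Measurable (Function.uncurry π)) :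
    Measurable (survTransition π : Traj d k → Measure (Traj d (k + 1))) := by
  refine Measure.measurable_of_measurable_coe _ fun C hC => ?_
  simp only [survTransition_apply π _ hC]
  refine Measurable.lintegral_prod_right' (f := fun p : Traj d k × State d =>
    π p.1.last p.2 * C.indicator 1 (p.1.extend p.2)) ?_
  exact (hπ.comp ((Traj.measurable_last.comp measurable_fst).prodMk measurable_snd)).mul
    ((measurable_one.indicator hC).comp Traj.measurable_extend)

lemma isProbabilityMeasure_survTransition {π : State d → State d → ℝ≥0∞}
    (hπ_one : ∀ x, ∫⁻ y, π x y = 1) (X : Traj d k) :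
    IsProbabilityMeasure (survTransition π X) := by
  refine ⟨?_⟩
  rw [survTransition_apply π X MeasurableSet.univ]
  simp [hπ_one]

/-- The function `⟨f; π^c P^S⟩` is the density of the measure `∫ f P^S π^c(· | X') dX'`. -/
lemma withDensity_survTransInner {PS : State d → ℝ≥0∞} (hPS : Measurable PS)
    {π : State d → State d → ℝ≥0∞} (hπ : Measurable (Function.uncurry π))
    {f : Traj d k → ℝ≥0∞} (hf : Measurable f) :
    (trajMeasure d (k + 1)).withDensity (survTransInner PS π f) =
      ((trajMeasure d k).withDensity fun X' => f X' * survProb PS k X').bind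
        (survTransition π) := by
  ext C hC
  have hm := measurable_survTransInner hPS hπ hf
  have hπ' (X : Traj d k) : Measurable (π X.last) := hπ.comp measurable_prodMk_left
  have hX (X : Traj d k) : Measurable X.extend :=
    Traj.measurable_extend.comp measurable_prodMk_left
  rw [withDensity_apply _ hC, Measure.bind_apply hC (measurable_survTransition hπ).aemeasurable,
    lintegral_withDensity_eq_lintegral_mul (g := fun X => survTransition π X C) _
      (show Measurable fun X => f X * survProb PS k X from hf.mul (measurable_survProb hPS))
      ((Measure.measurable_coe hC).comp (measurable_survTransition hπ)),
    ← lintegral_indicator hC, lintegral_trajMeasure_succ (hm.indicator hC)]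
  · refine lintegral_congr fun X => ?_
    rw [Pi.mul_apply, survTransition_apply π X hC, ← lintegral_const_mul]
    · refine lintegral_congr fun y => ?_
      by_cases h : X.extend y ∈ C
      · simp [h, survTransInner_extend]
      · simp [h]
    · exact (hπ' X).mul ((measurable_one.indicator hC).comp (hX X))
  · intro X h
    simp [survTransInner, h]

lemma measurable_birthDensity {fb : State d → ℝ≥0∞} (hfb : Measurable fb) :
    Measurable (birthDensity fb k) := by
  refine measurable_sigma fun I => ?_
  by_cases h : I.1.2 = k ∧ I.1.1 = k
  · simp only [birthDensity, Traj.endTime, Traj.birthTime, h, and_self, if_true]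
    exact hfb.comp (measurable_pi_apply (Fin.last (I.1.2 - I.1.1)))
  · simp only [birthDensity, Traj.endTime, Traj.birthTime, h, if_false]
    exact measurable_const

lemma lintegral_birthDensity {fb : State d → ℝ≥0∞} (hfb : Measurable fb) :
    ∫⁻ X, birthDensity fb k X ∂(trajMeasure d k) = ∫⁻ x, fb x := by
  have hone (M : ℕ) (hM : M = 0) :
      ∫⁻ x : Fin (M + 1) → State d, fb (x (Fin.last _)) = ∫⁻ x, fb x := by
    subst hM
    have := lintegral_pi_prod (volume : Measure (State d)) (m := 1) (fun _ => fb) fun _ => hfb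
    rw [volume_pi]
    simpa using this
  rw [lintegral_trajMeasure, tsum_eq_single ⟨(k, k), le_rfl, le_rfl⟩]
  · rw [← hone (k - k) (Nat.sub_self k)]
    refine lintegral_congr fun x => ?_
    simp [birthDensity, Traj.endTime, Traj.birthTime, Traj.last]
  · intro I hI
    have : ¬ (I.1.2 = k ∧ I.1.1 = k) := fun h => hI (Subtype.ext (Prod.ext h.2 h.1))
    simp [birthDensity, Traj.endTime, Traj.birthTime, this]

lemma isBernoulliParam_birthDensity {rb : ℝ≥0∞} {fb : State d → ℝ≥0∞}
    (hb : IsBernoulliParam volume rb fb) :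
    IsBernoulliParam (trajMeasure d k) rb (birthDensity fb k) where
  le_one := hb.le_one
  measurable := measurable_birthDensity hb.measurable
  lintegral_eq_one h := by rw [lintegral_birthDensity hb.measurable, hb.lintegral_eq_one h]

end Traj

/-! ### The generating functional of a mixture -/

namespace TrajMBM

variable {d k n : ℕ} (θ : TrajMBM d k n) (𝓜 : Finset (ℕ × ℕ))

lemma mem_globalHyps {a : Fin n → ℕ} :
    a ∈ θ.globalHyps 𝓜 ↔ (∀ i, a i ∈ Finset.Icc 1 (θ.h i)) ∧ (∀ i, θ.hist i (a i) ⊆ 𝓜) ∧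
      ∀ i j, i ≠ j → Disjoint (θ.hist i (a i)) (θ.hist j (a j)) := by
  classical
  rw [globalHyps, Finset.mem_filter, Fintype.mem_piFinset, Finset.biUnion_subset]
  simp

lemma density_eq (F : FinSub (Traj d k)) :
    θ.density 𝓜 F = ∑ a ∈ θ.globalHyps 𝓜, (θ.globalWeight 𝓜 a : ℝ≥0∞) *
      multiBernoulliDensity (fun i => θ.r i (a i)) (fun i => θ.f i (a i)) F := rfl

variable {θ 𝓜}

lemma sum_globalWeight (hθ : θ.Valid 𝓜) :
    ∑ a ∈ θ.globalHyps 𝓜, (θ.globalWeight 𝓜 a : ℝ≥0∞) = 1 := by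
  rw [← ENNReal.ofNNReal_finsetSum]
  simp only [globalWeight]
  rw [← Finset.sum_div, div_self hθ.weight_ne_zero, ENNReal.coe_one]

lemma Valid.measurable (hθ : θ.Valid 𝓜) {a : Fin n → ℕ} (ha : a ∈ θ.globalHyps 𝓜) (i : Fin n) :
    Measurable (θ.f i (a i)) :=
  (hθ.bernoulli i _ (((θ.mem_globalHyps 𝓜).1 ha).1 i)).measurable

lemma aemeasurable_density (hd : 0 < d) (hθ : θ.Valid 𝓜) (m : ℕ) :
    AEMeasurable (fun x : Fin m → Traj d k => θ.density 𝓜 (tupleSet x))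
      (Measure.pi fun _ => trajMeasure d k) := by
  have := nullSingletonClass_trajMeasure (k := k) hd
  simp only [density_eq]
  exact Finset.aemeasurable_fun_sum _ fun a ha =>
    (aemeasurable_multiBernoulliDensity _ m (hθ.measurable ha)).const_mul _

lemma setIntegral_density_mul_prod (hd : 0 < d) (hθ : θ.Valid 𝓜) {h : Traj d k → ℝ≥0∞}
    (hh : Measurable h) (h_top : ∀ X, h X ≠ ∞) :
    setIntegral (trajMeasure d k) (fun F => θ.density 𝓜 F * ∏ X ∈ F.pts, h X) =
      ∑ a ∈ θ.globalHyps 𝓜, (θ.globalWeight 𝓜 a : ℝ≥0∞) *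
        ∏ i, (1 - θ.r i (a i) +
          θ.r i (a i) * ∫⁻ X, θ.f i (a i) X * h X ∂(trajMeasure d k)) := by
  have := nullSingletonClass_trajMeasure (k := k) hd
  have hφ (m : ℕ) : Measurable fun x : Fin m → Traj d k => ∏ X ∈ (tupleSet x).pts, h X :=
    (measurable_prod_pts hh h_top).comp (measurable_tupleSet m)
  have hm (m : ℕ) (a : Fin n → ℕ) (ha : a ∈ θ.globalHyps 𝓜) :
      AEMeasurable (fun x : Fin m → Traj d k => multiBernoulliDensity (fun i => θ.r i (a i))
        (fun i => θ.f i (a i)) (tupleSet x) * ∏ X ∈ (tupleSet x).pts, h X)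
        (Measure.pi fun _ => trajMeasure d k) :=
    (aemeasurable_multiBernoulliDensity _ m (hθ.measurable ha)).mul (hφ m).aemeasurable
  rw [Finset.sum_congr rfl fun a ha => congrArg _
    (setIntegral_multiBernoulliDensity_mul_prod (trajMeasure d k) (hθ.measurable ha) hh).symm]
  simp only [setIntegral, density_eq, ← ENNReal.tsum_mul_left]
  rw [← Summable.tsum_finsetSum fun _ _ => ENNReal.summable]
  refine tsum_congr fun m => ?_
  simp only [Finset.sum_mul, mul_assoc]
  rw [lintegral_finsetSum' _ fun a ha => (hm m a ha).const_mul _, Finset.mul_sum]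
  refine Finset.sum_congr rfl fun a ha => ?_
  rw [lintegral_const_mul'' _ (hm m a ha), mul_left_comm]

/-- The void probabilities of a mixture. -/
lemma setMeasure_density_voidEvent (hd : 0 < d) (hθ : θ.Valid 𝓜) {C : Set (Traj d k)}
    (hC : MeasurableSet C) :
    setMeasure (trajMeasure d k) (θ.density 𝓜) (voidEvent C) =
      ∑ a ∈ θ.globalHyps 𝓜, (θ.globalWeight 𝓜 a : ℝ≥0∞) *
        ∏ i, (1 - θ.r i (a i) + θ.r i (a i) * ∫⁻ X in Cᶜ, θ.f i (a i) X ∂(trajMeasure d k)) := by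
  classical
  -- The indicator of the void event is the point product of the indicator of `Cᶜ`.
  have h1 : (voidEvent C).indicator (θ.density 𝓜) =
      fun F => θ.density 𝓜 F * ∏ X ∈ F.pts, Cᶜ.indicator 1 X := by
    funext F
    have : ∏ X ∈ F.pts, Cᶜ.indicator (1 : Traj d k → ℝ≥0∞) X =
        if F ∈ voidEvent C then 1 else 0 := by
      simp only [Set.indicator_apply, Pi.one_apply, Finset.prod_boole]
      congr!
    rw [this, Set.indicator_apply, mul_ite, mul_one, mul_zero]
  rw [setMeasure_apply _ _ (measurableSet_voidEvent hC), h1,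
    setIntegral_density_mul_prod hd hθ (measurable_one.indicator hC.compl)]
  · refine Finset.sum_congr rfl fun a _ => ?_
    congr 1
    refine Finset.prod_congr rfl fun i _ => ?_
    rw [← lintegral_indicator hC.compl]
    congr 2
    refine lintegral_congr fun X => ?_
    by_cases hX : X ∈ Cᶜ <;> simp [hX]
  · intro X
    rw [Set.indicator_apply]
    split_ifs <;> simp

lemma isProbabilityMeasure_setMeasure_density (hd : 0 < d) (hθ : θ.Valid 𝓜) :
    IsProbabilityMeasure (setMeasure (trajMeasure d k) (θ.density 𝓜)) := by
  refine ⟨?_⟩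
  rw [← voidEvent_empty, setMeasure_density_voidEvent hd hθ MeasurableSet.empty]
  refine Eq.trans (Finset.sum_congr rfl fun a ha => ?_) (sum_globalWeight hθ)
  rw [Finset.prod_eq_one, mul_one]
  intro i _
  have hb := hθ.bernoulli i _ (((θ.mem_globalHyps 𝓜).1 ha).1 i)
  rw [Set.compl_empty, setLIntegral_univ]
  rcases eq_or_ne (θ.r i (a i)) 0 with h | h
  · rw [h]
    simp
  · rw [hb.lintegral_eq_one h, mul_one, tsub_add_cancel_of_le hb.le_one]

end TrajMBM

/-! ### The transition kernel -/

section Transition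

variable {d k nb : ℕ} {PS : State d → ℝ≥0∞} {π : State d → State d → ℝ≥0∞}
  {rb : Fin nb → ℝ≥0∞} {fb : Fin nb → State d → ℝ≥0∞}

/-- The probability that a trajectory present at time step `k` leaves no trajectory in `C` at time
step `k + 1`. -/
noncomputable def survVoid (PS : State d → ℝ≥0∞) (π : State d → State d → ℝ≥0∞)
    (C : Set (Traj d (k + 1))) (X : Traj d k) : ℝ≥0∞ :=
  1 - survProb PS k X + survProb PS k X * survTransition π X Cᶜ

lemma isProbabilityMeasure_birthLaw (hb : ∀ l, IsBernoulliParam volume (rb l) (fb l))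
    (l : Fin nb) : IsProbabilityMeasure
      (bernoulliLaw (rb l) ((trajMeasure d k).withDensity (birthDensity (fb l) k))) :=
  isProbabilityMeasure_bernoulliLaw (hb l).le_one fun h => by
    rw [withDensity_apply _ MeasurableSet.univ, setLIntegral_univ,
      (isBernoulliParam_birthDensity (hb l)).lintegral_eq_one h]

lemma isProbabilityMeasure_survLaw (hPS_le : ∀ x, PS x ≤ 1) (hπ_one : ∀ x, ∫⁻ y, π x y = 1)
    (X : Traj d k) :
    IsProbabilityMeasure (bernoulliLaw (survProb PS k X) (survTransition π X)) :=
  have := isProbabilityMeasure_survTransition hπ_one X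
  isProbabilityMeasure_bernoulliLaw (survProb_le_one hPS_le X) fun _ => measure_univ

lemma survVoid_le_one (hPS_le : ∀ x, PS x ≤ 1) (hπ_one : ∀ x, ∫⁻ y, π x y = 1)
    (C : Set (Traj d (k + 1))) (X : Traj d k) : survVoid PS π C X ≤ 1 := by
  have := isProbabilityMeasure_survTransition hπ_one X
  calc survVoid PS π C X ≤ 1 - survProb PS k X + survProb PS k X * 1 := by
        unfold survVoid
        gcongr
        exact prob_le_one
    _ = 1 := by rw [mul_one, tsub_add_cancel_of_le (survProb_le_one hPS_le X)]

lemma measurable_survVoid (hPS : Measurable PS) (hπ : Measurable (Function.uncurry π))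
    {C : Set (Traj d (k + 1))} (hC : MeasurableSet C) :
    Measurable (survVoid PS π C : Traj d k → ℝ≥0∞) :=
  ((measurable_survProb hPS).const_sub 1).add ((measurable_survProb hPS).mul
    ((Measure.measurable_coe hC.compl).comp (measurable_survTransition hπ)))

lemma currentTransition_voidEvent (hPS_le : ∀ x, PS x ≤ 1) (hπ_one : ∀ x, ∫⁻ y, π x y = 1)
    (hb : ∀ l, IsBernoulliParam volume (rb l) (fb l)) {C : Set (Traj d (k + 1))}
    (hC : MeasurableSet C) (F : FinSub (Traj d k)) :
    currentTransition PS π rb fb k F (voidEvent C) =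
      (∏ l, (1 - rb l + rb l * ∫⁻ X in Cᶜ, birthDensity (fb l) (k + 1) X
        ∂(trajMeasure d (k + 1)))) * ∏ X ∈ F.pts, survVoid PS π C X := by
  have h1 := isProbabilityMeasure_birthLaw (k := k + 1) hb
  have h2 (X : Traj d k) := isProbabilityMeasure_survLaw hPS_le hπ_one X
  have h3 := isProbabilityMeasure_unionLaw fun l : Fin nb =>
    bernoulliLaw (rb l) ((trajMeasure d (k + 1)).withDensity (birthDensity (fb l) (k + 1)))
  have h4 := isProbabilityMeasure_unionLaw fun X' : {X' // X' ∈ F.pts} =>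
    bernoulliLaw (survProb PS k X'.1) (survTransition π X'.1)
  rw [currentTransition, unionLaw₂_voidEvent _ _ hC, unionLaw_voidEvent _ hC,
    unionLaw_voidEvent _ hC]
  simp only [bernoulliLaw_voidEvent _ _ hC, withDensity_apply _ hC.compl]
  congr 1
  exact Finset.prod_coe_sort F.pts (survVoid PS π C)

lemma isProbabilityMeasure_currentTransition (hPS_le : ∀ x, PS x ≤ 1)
    (hπ_one : ∀ x, ∫⁻ y, π x y = 1) (hb : ∀ l, IsBernoulliParam volume (rb l) (fb l))
    (F : FinSub (Traj d k)) : IsProbabilityMeasure (currentTransition PS π rb fb k F) :=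
  have _ := isProbabilityMeasure_birthLaw (k := k + 1) hb
  have _ (X : Traj d k) := isProbabilityMeasure_survLaw hPS_le hπ_one X
  have _ := isProbabilityMeasure_unionLaw fun l : Fin nb =>
    bernoulliLaw (rb l) ((trajMeasure d (k + 1)).withDensity (birthDensity (fb l) (k + 1)))
  have _ := isProbabilityMeasure_unionLaw fun X' : {X' // X' ∈ F.pts} =>
    bernoulliLaw (survProb PS k X'.1) (survTransition π X'.1)
  isProbabilityMeasure_unionLaw₂ _ _

/-- The transition law is a Markov kernel, so that averaging it over a distribution with
`Measure.bind` is meaningful. -/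
lemma measurable_currentTransition (hPS : Measurable PS) (hPS_le : ∀ x, PS x ≤ 1)
    (hπ : Measurable (Function.uncurry π)) (hπ_one : ∀ x, ∫⁻ y, π x y = 1)
    (hb : ∀ l, IsBernoulliParam volume (rb l) (fb l)) :
    Measurable (currentTransition PS π rb fb k) := by
  have := isProbabilityMeasure_currentTransition (k := k) hPS_le hπ_one hb
  refine measurable_measure_of_voidEvent fun C hC => ?_
  simp only [currentTransition_voidEvent hPS_le hπ_one hb hC]
  exact (measurable_prod_pts (measurable_survVoid hPS hπ hC) fun X =>
    ((survVoid_le_one hPS_le hπ_one C X).trans_lt ENNReal.one_lt_top).ne).const_mul _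

end Transition

/-! ### Prediction of a single track -/

section Track

variable {d k : ℕ} {PS : State d → ℝ≥0∞} {π : State d → State d → ℝ≥0∞} {r : ℝ≥0∞}
  {f : Traj d k → ℝ≥0∞}

lemma setLIntegral_survTransInner (hPS : Measurable PS) (hπ : Measurable (Function.uncurry π))
    (hf : Measurable f) {C : Set (Traj d (k + 1))} (hC : MeasurableSet C) :
    ∫⁻ X in C, survTransInner PS π f X ∂(trajMeasure d (k + 1)) =
      ∫⁻ X, f X * (survProb PS k X * survTransition π X C) ∂(trajMeasure d k) := by
  have hT : Measurable fun X : Traj d k => survTransition π X C :=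
    (Measure.measurable_coe hC).comp (measurable_survTransition hπ)
  rw [← withDensity_apply _ hC, withDensity_survTransInner hPS hπ hf,
    Measure.bind_apply hC (measurable_survTransition hπ).aemeasurable,
    lintegral_withDensity_eq_lintegral_mul _
      (show Measurable fun X => f X * survProb PS k X from hf.mul (measurable_survProb hPS)) hT]
  exact lintegral_congr fun X => mul_assoc _ _ _

lemma lintegral_survTransInner (hPS : Measurable PS) (hπ : Measurable (Function.uncurry π))
    (hπ_one : ∀ x, ∫⁻ y, π x y = 1) (hf : Measurable f) :
    ∫⁻ X, survTransInner PS π f X ∂(trajMeasure d (k + 1)) = survInner PS f := by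
  have (X : Traj d k) := isProbabilityMeasure_survTransition hπ_one X
  rw [← setLIntegral_univ, setLIntegral_survTransInner hPS hπ hf MeasurableSet.univ]
  simp [survInner]

lemma survInner_le_one (hPS_le : ∀ x, PS x ≤ 1)
    (hf_one : ∫⁻ X, f X ∂(trajMeasure d k) = 1) : survInner PS f ≤ 1 := by
  rw [← hf_one, survInner]
  exact lintegral_mono fun X => mul_le_of_le_one_right' (survProb_le_one hPS_le X)

/-- When `r * ⟨f; P^S⟩ = 0` the mass of the predicted density is unconstrained, which covers the
division by `0`; otherwise `⟨f; P^S⟩` is positive and at most `1`. -/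
lemma isBernoulliParam_predict (hPS : Measurable PS) (hPS_le : ∀ x, PS x ≤ 1)
    (hπ : Measurable (Function.uncurry π)) (hπ_one : ∀ x, ∫⁻ y, π x y = 1)
    (h : IsBernoulliParam (trajMeasure d k) r f) :
    IsBernoulliParam (trajMeasure d (k + 1)) (r * survInner PS f)
      (fun X => survTransInner PS π f X / survInner PS f) where
  le_one := by
    rcases eq_or_ne r 0 with rfl | hr
    · simp
    · exact mul_le_one' h.le_one (survInner_le_one hPS_le (h.lintegral_eq_one hr))
  measurable := (measurable_survTransInner hPS hπ h.measurable).div_const _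
  lintegral_eq_one hne := by
    have hs := survInner_le_one hPS_le (h.lintegral_eq_one (left_ne_zero_of_mul hne))
    simp only [div_eq_mul_inv]
    rw [lintegral_mul_const _ (measurable_survTransInner hPS hπ h.measurable),
      lintegral_survTransInner hPS hπ hπ_one h.measurable]
    exact ENNReal.mul_inv_cancel (right_ne_zero_of_mul hne) (hs.trans_lt ENNReal.one_lt_top).ne

/-- A Bernoulli track that is thinned by survival and displaced by the Markov transition is again
Bernoulli: the generating functional at `survVoid` equals the void probability of the predicted
track. -/
lemma pgfl_predict (hPS : Measurable PS) (hPS_le : ∀ x, PS x ≤ 1)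
    (hπ : Measurable (Function.uncurry π)) (hπ_one : ∀ x, ∫⁻ y, π x y = 1)
    (h : IsBernoulliParam (trajMeasure d k) r f) {C : Set (Traj d (k + 1))}
    (hC : MeasurableSet C) :
    1 - r + r * ∫⁻ X, f X * survVoid PS π C X ∂(trajMeasure d k) =
      1 - r * survInner PS f + r * survInner PS f *
        ∫⁻ X in Cᶜ, survTransInner PS π f X / survInner PS f ∂(trajMeasure d (k + 1)) := by
  rcases eq_or_ne r 0 with rfl | hr
  · simp
  have hf := h.measurable
  have hp := measurable_survProb (k := k) hPS
  have hs := survInner_le_one hPS_le (h.lintegral_eq_one hr)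
  have hs_top : survInner PS f ≠ ∞ := (hs.trans_lt ENNReal.one_lt_top).ne
  have hr_top : r ≠ ∞ := (h.le_one.trans_lt ENNReal.one_lt_top).ne
  set J := ∫⁻ X in Cᶜ, survTransInner PS π f X ∂(trajMeasure d (k + 1)) with hJ
  have hfp : Measurable fun X => f X * (1 - survProb PS k X) := hf.mul (hp.const_sub 1)
  have h1 : ∫⁻ X, f X * (1 - survProb PS k X) ∂(trajMeasure d k) = 1 - survInner PS f := by
    refine ENNReal.eq_sub_of_add_eq hs_top ?_
    rw [survInner, ← lintegral_add_left hfp]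
    refine (lintegral_congr fun X => ?_).trans (h.lintegral_eq_one hr)
    rw [← mul_add, tsub_add_cancel_of_le (survProb_le_one hPS_le X), mul_one]
  have h2 : ∫⁻ X, f X * survVoid PS π C X ∂(trajMeasure d k) = 1 - survInner PS f + J := by
    rw [hJ, setLIntegral_survTransInner hPS hπ hf hC.compl, ← h1,
      ← lintegral_add_left hfp]
    exact lintegral_congr fun X => mul_add _ _ _
  have h3 : survInner PS f *
      ∫⁻ X in Cᶜ, survTransInner PS π f X / survInner PS f ∂(trajMeasure d (k + 1)) = J := by
    simp only [div_eq_mul_inv]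
    rw [lintegral_mul_const _ (measurable_survTransInner hPS hπ hf), ← hJ]
    -- If `⟨f; P^S⟩ = 0`, the predicted density is a junk value, but `J` vanishes as well.
    rcases eq_or_ne (survInner PS f) 0 with h0 | h0
    · have : J ≤ survInner PS f := by
        rw [hJ, ← lintegral_survTransInner hPS hπ hπ_one hf]
        exact setLIntegral_le_lintegral _ _
      rw [h0, zero_mul]
      exact (nonpos_iff_eq_zero.1 (h0 ▸ this)).symm
    · rw [mul_left_comm, ENNReal.mul_inv_cancel h0 hs_top, mul_one]
  rw [h2, mul_assoc, h3, mul_add, ← add_assoc, ENNReal.mul_sub fun _ _ => hr_top, mul_one,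
    tsub_add_tsub_cancel h.le_one (mul_le_of_le_one_right' hs)]

end Track

/-! ### The predicted mixture -/

namespace TrajMBM

variable {d k n nb : ℕ} (θ : TrajMBM d k n) (𝓜 : Finset (ℕ × ℕ)) (PS : State d → ℝ≥0∞)
  (π : State d → State d → ℝ≥0∞) (rb : Fin nb → ℝ≥0∞) (fb : Fin nb → State d → ℝ≥0∞)

/-- The predicted mixture: the tracks of `θ` propagated by survival and transition, followed by one
track with a single hypothesis and empty measurement history for each Bernoulli birth component. -/
noncomputable def predict : TrajMBM d (k + 1) (n + nb) where
  h := Fin.append θ.h fun _ => 1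
  hist := Fin.append θ.hist fun _ _ => ∅
  w := Fin.append θ.w fun _ _ => 1
  r := Fin.append (fun i a => θ.r i a * survInner PS (θ.f i a)) fun l _ => rb l
  f := Fin.append (fun i a X => survTransInner PS π (θ.f i a) X / survInner PS (θ.f i a))
    fun l _ => birthDensity (fb l) (k + 1)

/-- The global hypotheses of the predicted mixture are those of `θ`, with the only hypothesis chosen
for every new track. -/
lemma sum_globalHyps_predict {M : Type*} [AddCommMonoid M] (Φ : (Fin (n + nb) → ℕ) → M) :
    ∑ b ∈ (θ.predict PS π rb fb).globalHyps 𝓜, Φ b =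
      ∑ a ∈ θ.globalHyps 𝓜, Φ (Fin.append a fun _ => 1) := by
  symm
  refine Finset.sum_bij (fun a _ => Fin.append a fun _ => 1) ?_ ?_ ?_ fun _ _ => rfl
  · intro a ha
    rw [mem_globalHyps] at ha ⊢
    simpa [Fin.forall_fin_add, predict] using ha
  · intro a _ b _ h
    funext i
    simpa using congrFun h (Fin.castAdd nb i)
  · intro b hb
    rw [mem_globalHyps] at hb
    simp only [Fin.forall_fin_add, predict, Fin.append_left, Fin.append_right, Finset.Icc_self,
      Finset.mem_singleton] at hb
    refine ⟨fun i => b (Fin.castAdd nb i), (θ.mem_globalHyps 𝓜).2 ⟨hb.1.1, hb.2.1.1, ?_⟩, ?_⟩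
    · intro i j hij
      exact (hb.2.2.1 i).1 j (by simpa using hij)
    · funext i
      refine Fin.addCases (fun i => ?_) (fun l => ?_) i
      · rw [Fin.append_left]
      · rw [Fin.append_right, hb.1.2]

lemma prod_w_predict (a : Fin n → ℕ) :
    ∏ i, (θ.predict PS π rb fb).w i (Fin.append a (fun _ => 1) i) = ∏ i, θ.w i (a i) := by
  simp [Fin.prod_univ_add, predict]

lemma globalWeight_predict (a : Fin n → ℕ) :
    (θ.predict PS π rb fb).globalWeight 𝓜 (Fin.append a fun _ => 1) = θ.globalWeight 𝓜 a := by
  simp only [globalWeight, sum_globalHyps_predict, prod_w_predict]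

variable {θ 𝓜 PS π rb fb}

lemma valid_predict (hPS : Measurable PS) (hPS_le : ∀ x, PS x ≤ 1)
    (hπ : Measurable (Function.uncurry π)) (hπ_one : ∀ x, ∫⁻ y, π x y = 1)
    (hb : ∀ l, IsBernoulliParam volume (rb l) (fb l)) (hθ : θ.Valid 𝓜) :
    (θ.predict PS π rb fb).Valid 𝓜 where
  bernoulli i := by
    refine Fin.addCases (fun i => ?_) (fun l => ?_) i
    · intro a ha
      simp only [predict, Fin.append_left] at ha ⊢
      exact isBernoulliParam_predict hPS hPS_le hπ hπ_one (hθ.bernoulli i a ha)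
    · intro a _
      simp only [predict, Fin.append_right]
      exact isBernoulliParam_birthDensity (hb l)
  weight_ne_zero := by
    simp only [sum_globalHyps_predict, prod_w_predict]
    exact hθ.weight_ne_zero

/-- The predicted distribution has the density of the predicted mixture, because both have the same
void probabilities. -/
lemma hasSetDensity_predict (hd : 0 < d) (hPS : Measurable PS) (hPS_le : ∀ x, PS x ≤ 1)
    (hπ : Measurable (Function.uncurry π)) (hπ_one : ∀ x, ∫⁻ y, π x y = 1)
    (hb : ∀ l, IsBernoulliParam volume (rb l) (fb l)) (hθ : θ.Valid 𝓜)
    {P : Measure (FinSub (Traj d k))} (hP : HasSetDensity (trajMeasure d k) P (θ.density 𝓜)) :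
    HasSetDensity (trajMeasure d (k + 1)) (P.bind (currentTransition PS π rb fb k))
      ((θ.predict PS π rb fb).density 𝓜) := by
  have hθ' := valid_predict (nb := nb) hPS hPS_le hπ hπ_one hb hθ
  have := isProbabilityMeasure_setMeasure_density hd hθ'
  obtain rfl := hasSetDensity_iff.1 hP
  refine hasSetDensity_iff.2 (Eq.symm (ext_of_voidEvent fun C hC => ?_))
  have hq_top (X : Traj d k) : survVoid PS π C X ≠ ∞ :=
    ((survVoid_le_one hPS_le hπ_one C X).trans_lt ENNReal.one_lt_top).ne
  have hq := measurable_survVoid (k := k) hPS hπ hC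
  have hprod := measurable_prod_pts hq hq_top
  rw [setMeasure_density_voidEvent hd hθ' hC, sum_globalHyps_predict,
    Measure.bind_apply (measurableSet_voidEvent hC)
      (measurable_currentTransition hPS hPS_le hπ hπ_one hb).aemeasurable]
  simp only [currentTransition_voidEvent hPS_le hπ_one hb hC, globalWeight_predict]
  rw [lintegral_const_mul _ hprod, lintegral_setMeasure (aemeasurable_density hd hθ) hprod,
    setIntegral_density_mul_prod hd hθ hq hq_top, Finset.mul_sum]
  refine Finset.sum_congr rfl fun a ha => ?_
  rw [Finset.prod_congr rfl fun i _ => pgfl_predict hPS hPS_le hπ hπ_one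
    (hθ.bernoulli i _ (((θ.mem_globalHyps 𝓜).1 ha).1 i)) hC, Fin.prod_univ_add]
  simp only [predict, Fin.append_left, Fin.append_right]
  ring

end TrajMBM

end TrajRFS

theorem theorem1 {d : ℕ} (hd : 0 < d) (k n nb : ℕ) (m : ℕ → ℕ)
    (PS : State d → ℝ≥0∞) (hPS : Measurable PS) (hPS_le : ∀ x, PS x ≤ 1)
    (π : State d → State d → ℝ≥0∞) (hπ : Measurable (Function.uncurry π))
    (hπ_one : ∀ x, ∫⁻ y, π x y = 1)
    (rb : Fin nb → ℝ≥0∞) (fb : Fin nb → State d → ℝ≥0∞)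
    (hb : ∀ l, IsBernoulliParam volume (rb l) (fb l))
    (θ : TrajMBM d k n) (hθ : θ.Valid (measIndices m k))
    (P : Measure (FinSub (Traj d k)))
    (hP : HasSetDensity (trajMeasure d k) P (θ.density (measIndices m k))) :
    (∀ i, ∀ a ∈ Finset.Icc 1 (θ.h i),
      (trajMeasure d (k + 1)).withDensity (survTransInner PS π (θ.f i a)) =
        ((trajMeasure d k).withDensity fun X' => θ.f i a X' * survProb PS k X').bind
          (survTransition π)) ∧
    ∃ θ' : TrajMBM d (k + 1) (n + nb),
      θ'.Valid (measIndices m k) ∧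
      HasSetDensity (trajMeasure d (k + 1)) (P.bind (currentTransition PS π rb fb k))
        (θ'.density (measIndices m k)) ∧
      (∀ i : Fin n,
        θ'.h (Fin.castAdd nb i) = θ.h i ∧
        ∀ a ∈ Finset.Icc 1 (θ.h i),
          θ'.hist (Fin.castAdd nb i) a = θ.hist i a ∧
          θ'.w (Fin.castAdd nb i) a = θ.w i a ∧
          θ'.r (Fin.castAdd nb i) a = θ.r i a * survInner PS (θ.f i a) ∧
          ∀ X, θ'.f (Fin.castAdd nb i) a X =
            survTransInner PS π (θ.f i a) X / survInner PS (θ.f i a)) ∧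
      (∀ l : Fin nb,
        θ'.h (Fin.natAdd n l) = 1 ∧
        θ'.hist (Fin.natAdd n l) 1 = ∅ ∧
        θ'.w (Fin.natAdd n l) 1 = 1 ∧
        θ'.r (Fin.natAdd n l) 1 = rb l ∧
        ∀ X, θ'.f (Fin.natAdd n l) 1 X = birthDensity (fb l) (k + 1) X) := by
  refine ⟨fun i a ha => withDensity_survTransInner hPS hπ (hθ.bernoulli i a ha).measurable,
    θ.predict PS π rb fb, TrajMBM.valid_predict hPS hPS_le hπ hπ_one hb hθ,
    TrajMBM.hasSetDensity_predict hd hPS hPS_le hπ hπ_one hb hθ hP, fun i => ?_, fun l => ?_⟩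
  · simp [TrajMBM.predict]
  · simp [TrajMBM.predict]
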